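/- Let $\mathbb T=\mathbb R/\mathbb Z$, let $G$ be the Heisenberg group of real matrices $\begin{pmatrix}1&a&c\\0&1&b\\0&0&1\end{pmatrix}$, let $\Gamma\subset G$ be the subgroup of integer matrices, and let $\Gamma\backslash G$ be the compact space of cosets $\Gamma g$. For real $r>1$, a continuous function $f:\mathbb R\to\mathbb R$ of period $1$ is called $C^r$-smooth if its Fourier coefficients satisfy $\widehat f(n)=O(|n|^{-r})$ for $n\neq 0$. For a homeomorphism $T$ of a compact space $X$ let $M(X,T)$ be the set of $T$-invariant Borel probability measures. For $\nu\in M(X,T)$, the system $(X,T,\nu)$ has *polynomial rate of rigidity* if there is a set $\mathcal F\subset C(X)$ of continuous complex-valued functions, whose linear span is dense in $C(X)$, such that for every $f\in\mathcal F$ there are $\delta>0$ and a strictly increasing sequence $(r_n)$ of positive integers with $$\sum_{|j|\le r_n^{\delta}}\|f\circ T^{jr_n}-f\|_{L^2(\nu)}^2\longrightarrow 0\qquad(n\to\infty).\tag{1}$$ **Theorem 1.1.** Let $\alpha\in[0,1)$ be irrational and $0<\varepsilon<10^{-2}$. Let $\varphi,\eta,\psi:\mathbb R\to\mathbb R$ be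 continuous functions of period $1$ such that $\psi$ is $C^{1+\varepsilon}$-smooth, $\varphi$ and $\eta$ are $C^{2+2\varepsilon}$-smooth, and $\int_0^1\varphi(t)\,dt=\int_0^1\eta(t)\,dt=0$ (it is not assumed that $\varphi=\eta$). Let $S_\alpha$ be the homeomorphism of $\mathbb T\times\Gamma\backslash G$ given by $$S_\alpha(t,\Gamma g)=\left(t+\alpha,\ \Gamma g\begin{pmatrix}1&\varphi(t)&\psi(t)\\0&1&\eta(t)\\0&0&1\end{pmatrix}\right).$$ Then $(\mathbb T\times\Gamma\backslash G,S_\alpha,\nu)$ has polynomial rate of rigidity for every $\nu\in M(\mathbb T\times\Gamma\backslash G,S_\alpha)$. Moreover, let $q_0=1,q_1,q_2,\dots$ be the denominators of the continued-fraction convergents of $\alpha$. The rigidity times can be taken to be multiples of these: there are indices $m_1<m_2<\cdots$ and integers $v_n$ with $1\le v_n\le q_{m_n}^{\varepsilon/16}$ such that $r_n=v_nq_{m_n}$ is strictly increasing and, for every $\nu\in M(\mathbb T\times\Gamma\backslash G,S_\alpha)$, there is a set $\mathcal F$ with dense linear span in $C(\mathbb T\times\Gamma\backslash G)$ such that every $f\in\mathcal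 F$ satisfies (1), with $T=S_\alpha$, for this sequence $(r_n)$ and some $\delta>0$. -/

import Mathlib

open Filter Topology MeasureTheory

/-! ### The Heisenberg group -/

/-- The real Heisenberg group: `⟨a, c, b⟩` is the upper triangular matrix
`!![1, a, c; 0, 1, b; 0, 0, 1]` (see `Heis.toMatrix`, `Heis.toMatrix_mul`). -/
@[ext]
structure Heis where
  /-- the entry in row 1, column 2 -/
  a : ℝ
  /-- the entry in row 1, column 3 -/
  c : ℝ
  /-- the entry in row 2, column 3 -/
  b : ℝ

namespace Heis

/-- The matrix of an element of the Heisenberg group. -/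
def toMatrix (g : Heis) : Matrix (Fin 3) (Fin 3) ℝ :=
  !![1, g.a, g.c; 0, 1, g.b; 0, 0, 1]

instance : Mul Heis := ⟨fun g h => ⟨g.a + h.a, g.c + h.c + g.a * h.b, g.b + h.b⟩⟩
instance : One Heis := ⟨⟨0, 0, 0⟩⟩
instance : Inv Heis := ⟨fun g => ⟨-g.a, g.a * g.b - g.c, -g.b⟩⟩

@[simp] theorem mul_a (g h : Heis) : (g * h).a = g.a + h.a := rfl
@[simp] theorem mul_c (g h : Heis) : (g * h).c = g.c + h.c + g.a * h.b := rfl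
@[simp] theorem mul_b (g h : Heis) : (g * h).b = g.b + h.b := rfl
@[simp] theorem one_a : (1 : Heis).a = 0 := rfl
@[simp] theorem one_c : (1 : Heis).c = 0 := rfl
@[simp] theorem one_b : (1 : Heis).b = 0 := rfl
@[simp] theorem inv_a (g : Heis) : (g⁻¹).a = -g.a := rfl
@[simp] theorem inv_c (g : Heis) : (g⁻¹).c = g.a * g.b - g.c := rfl
@[simp] theorem inv_b (g : Heis) : (g⁻¹).b = -g.b := rfl

/-- The group law is matrix multiplication. -/
theorem toMatrix_mul (g h : Heis) : (g * h).toMatrix = g.toMatrix * h.toMatrix := by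
  ext i j
  fin_cases i <;> fin_cases j <;>
    simp [toMatrix, Matrix.mul_apply, Fin.sum_univ_three] <;> ring

theorem toMatrix_injective : Function.Injective toMatrix := by
  intro g h e
  ext
  · exact congrFun (congrFun e 0) 1
  · exact congrFun (congrFun e 0) 2
  · exact congrFun (congrFun e 1) 2

instance : Group Heis :=
  Group.ofLeftAxioms
    (fun g h k => by ext <;> simp <;> ring)
    (fun g => by ext <;> simp)
    (fun g => by ext <;> simp)

/-- The topology of a subspace of the space of real `3 × 3` matrices. -/
instance : TopologicalSpace Heis := TopologicalSpace.induced toMatrix inferInstance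

theorem continuous_a : Continuous Heis.a :=
  (continuous_induced_dom (f := toMatrix)).matrix_elem 0 1
theorem continuous_c : Continuous Heis.c :=
  (continuous_induced_dom (f := toMatrix)).matrix_elem 0 2
theorem continuous_b : Continuous Heis.b :=
  (continuous_induced_dom (f := toMatrix)).matrix_elem 1 2

theorem continuous_mk {Y : Type*} [TopologicalSpace Y] {u v w : Y → ℝ}
    (hu : Continuous u) (hv : Continuous v) (hw : Continuous w) :
    Continuous (fun y => (⟨u y, v y, w y⟩ : Heis)) := by
  refine continuous_induced_rng.2 (continuous_matrix fun i j => ?_)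
  fin_cases i <;> fin_cases j <;> simpa [toMatrix] using by fun_prop

instance : ContinuousMul Heis :=
  ⟨continuous_mk
    ((continuous_a.comp continuous_fst).add (continuous_a.comp continuous_snd))
    (((continuous_c.comp continuous_fst).add (continuous_c.comp continuous_snd)).add
      ((continuous_a.comp continuous_fst).mul (continuous_b.comp continuous_snd)))
    ((continuous_b.comp continuous_fst).add (continuous_b.comp continuous_snd))⟩

instance : ContinuousInv Heis :=
  ⟨continuous_mk continuous_a.neg ((continuous_a.mul continuous_b).sub continuous_c)
    continuous_b.neg⟩

instance : SecondCountableTopology Heis :=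
  haveI : SecondCountableTopology (Matrix (Fin 3) (Fin 3) ℝ) :=
    inferInstanceAs (SecondCountableTopology (Fin 3 → Fin 3 → ℝ))
  (Topology.IsInducing.mk rfl : Topology.IsInducing toMatrix).secondCountableTopology

/-- The lattice of integer matrices in the Heisenberg group. -/
def lattice : Subgroup Heis where
  carrier := {g | ∃ k m l : ℤ, g = ⟨k, m, l⟩}
  one_mem' := ⟨0, 0, 0, by ext <;> simp⟩
  mul_mem' := by
    rintro _ _ ⟨k, m, l, rfl⟩ ⟨k', m', l', rfl⟩
    exact ⟨k + k', m + m' + k * l', l + l', by ext <;> simp⟩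
  inv_mem' := by
    rintro _ ⟨k, m, l, rfl⟩
    exact ⟨-k, k * l - m, -l, by ext <;> simp⟩

end Heis

/-! ### The Heisenberg nilmanifold -/

/-- The nilmanifold `Γ \ G` of right cosets `Γ g`, with the quotient topology. -/
abbrev HeisNil : Type := Quotient (QuotientGroup.rightRel Heis.lattice)

namespace HeisNil

/-- The coset `Γ g`. -/
def mk (g : Heis) : HeisNil := Quotient.mk _ g

theorem isOpenQuotientMap_mk : IsOpenQuotientMap mk :=
  ⟨Quot.mk_surjective, continuous_quot_mk,
    isOpenMap_quotient_mk'_mul (Γ := Heis.lattice) (T := Heis)⟩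

/-- Right translation `(Γ g, h) ↦ Γ g h`. -/
def rmul (x : HeisNil) (h : Heis) : HeisNil :=
  Quotient.map (fun g => g * h) (fun g g' e => by
    rw [← Quotient.eq_iff_equiv, Quotient.eq, QuotientGroup.rightRel_apply] at e ⊢
    simpa [mul_assoc] using e) x

@[simp] theorem rmul_mk (g h : Heis) : rmul (mk g) h = mk (g * h) := rfl

theorem rmul_rmul (x : HeisNil) (g h : Heis) : rmul (rmul x g) h = rmul x (g * h) := by
  obtain ⟨k, rfl⟩ := isOpenQuotientMap_mk.surjective x
  simp [mul_assoc]

theorem rmul_one (x : HeisNil) : rmul x 1 = x := by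
  obtain ⟨k, rfl⟩ := isOpenQuotientMap_mk.surjective x
  simp

theorem continuous_rmul : Continuous (fun p : HeisNil × Heis => rmul p.1 p.2) := by
  have h := (isOpenQuotientMap_mk.prodMap (IsOpenQuotientMap.id (X := Heis)))
  rw [← h.continuous_comp_iff]
  exact isOpenQuotientMap_mk.continuous.comp continuous_mul

instance : SecondCountableTopology HeisNil :=
  TopologicalSpace.Quotient.secondCountableTopology isOpenQuotientMap_mk.isOpenMap

instance : CompactSpace HeisNil := by
  have hc : Continuous (fun p : ℝ × ℝ × ℝ => mk ⟨p.1, p.2.1, p.2.2⟩) :=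
    isOpenQuotientMap_mk.continuous.comp
      (Heis.continuous_mk (by fun_prop) (by fun_prop) (by fun_prop))
  have hK : IsCompact (Set.Icc (0 : ℝ) 1 ×ˢ Set.Icc (0 : ℝ) 1 ×ˢ Set.Icc (0 : ℝ) 1) :=
    isCompact_Icc.prod (isCompact_Icc.prod isCompact_Icc)
  refine ⟨(hK.image hc).of_isClosed_subset isClosed_univ fun x _ => ?_⟩
  obtain ⟨g, rfl⟩ := isOpenQuotientMap_mk.surjective x
  refine ⟨(Int.fract g.a, Int.fract (g.c - ⌊g.a⌋ * g.b), Int.fract g.b),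
    ⟨⟨Int.fract_nonneg _, (Int.fract_lt_one _).le⟩,
      ⟨Int.fract_nonneg _, (Int.fract_lt_one _).le⟩,
      ⟨Int.fract_nonneg _, (Int.fract_lt_one _).le⟩⟩, ?_⟩
  refine Quotient.sound ?_
  rw [← Quotient.eq_iff_equiv, Quotient.eq, QuotientGroup.rightRel_apply]
  refine ⟨⌊g.a⌋, ⌊g.c - ⌊g.a⌋ * g.b⌋ + ⌊g.a⌋ * ⌊g.b⌋, ⌊g.b⌋, ?_⟩
  rw [mul_inv_eq_iff_eq_mul]
  ext
  · simp
  · simp only [Heis.mul_c, Int.fract, Int.cast_add, Int.cast_mul]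
    ring
  · simp

/-- The nilmanifold carries its Borel `σ`-algebra. -/
instance : MeasurableSpace HeisNil := borel _
instance : BorelSpace HeisNil := ⟨rfl⟩

end HeisNil

/-- The phase space `𝕋 × Γ \ G`, with `𝕋 = ℝ / ℤ`. -/
abbrev CircleHeis : Type := UnitAddCircle × HeisNil

/-- The product `σ`-algebra on the phase space is its Borel `σ`-algebra. -/
theorem borelSpace_circleHeis : BorelSpace CircleHeis := inferInstance

/-! ### Periodic functions and their smoothness -/

/-- `f` is a continuous `1`-periodic real function of class `C^r`, where (as usual in this
context, for real `r > 1`) `C^r`-smoothness is expressed by the decay `O(|n|^{-r})` of the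
Fourier coefficients. -/
structure IsSmoothPeriodic (r : ℝ) (f : ℝ → ℝ) : Prop where
  periodic : Function.Periodic f 1
  continuous : Continuous f
  decay : ∃ C : ℝ, ∀ n : ℤ, n ≠ 0 →
    ‖fourierCoeffOn (zero_lt_one' ℝ) (fun t => (f t : ℂ)) n‖ ≤ C * |(n : ℝ)| ^ (-r)

/-- The function on the circle `ℝ / ℤ` induced by a continuous `1`-periodic function. -/
def circleFun (f : ℝ → ℝ) (hp : Function.Periodic f 1) (hc : Continuous f) :
    C(UnitAddCircle, ℝ) where
  toFun := hp.lift
  continuous_toFun := continuous_coinduced_dom.2 hc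

@[simp] theorem circleFun_coe (f : ℝ → ℝ) (hp : Function.Periodic f 1) (hc : Continuous f)
    (t : ℝ) : circleFun f hp hc (t : UnitAddCircle) = f t := rfl

/-! ### The skew product -/

/-- The fibre element `!![1, φ t, ψ t; 0, 1, η t; 0, 0, 1]`. -/
def cocycle (φ η ψ : C(UnitAddCircle, ℝ)) (t : UnitAddCircle) : Heis := ⟨φ t, ψ t, η t⟩

theorem continuous_cocycle (φ η ψ : C(UnitAddCircle, ℝ)) : Continuous (cocycle φ η ψ) :=
  Heis.continuous_mk φ.continuous ψ.continuous η.continuous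

/-- The skew product `S_α : (t, Γ g) ↦ (t + α, Γ g !![1, φ t, ψ t; 0, 1, η t; 0, 0, 1])`,
as a homeomorphism of `𝕋 × Γ \ G`. -/
def skewProduct (α : ℝ) (φ η ψ : C(UnitAddCircle, ℝ)) : CircleHeis ≃ₜ CircleHeis where
  toFun p := (p.1 + (α : UnitAddCircle), HeisNil.rmul p.2 (cocycle φ η ψ p.1))
  invFun p := (p.1 - (α : UnitAddCircle),
    HeisNil.rmul p.2 (cocycle φ η ψ (p.1 - (α : UnitAddCircle)))⁻¹)
  left_inv p := by simp [HeisNil.rmul_rmul, HeisNil.rmul_one]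
  right_inv p := by simp [HeisNil.rmul_rmul, HeisNil.rmul_one]
  continuous_toFun := (continuous_fst.add continuous_const).prodMk
    (HeisNil.continuous_rmul.comp
      (continuous_snd.prodMk ((continuous_cocycle φ η ψ).comp continuous_fst)))
  continuous_invFun := (continuous_fst.sub continuous_const).prodMk
    (HeisNil.continuous_rmul.comp
      (continuous_snd.prodMk
        ((continuous_cocycle φ η ψ).comp (continuous_fst.sub continuous_const)).inv))

/-! ### Polynomial rate of rigidity -/

section Rigidity

variable {X : Type*} [TopologicalSpace X] [CompactSpace X] [MeasurableSpace X] [BorelSpace X]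

/-- `ν` is a `T`-invariant Borel probability measure. -/
def IsInvariantProb (T : X ≃ₜ X) (ν : Measure X) : Prop :=
  IsProbabilityMeasure ν ∧ MeasurePreserving T ν ν

/-- `∑_{|j| ≤ r_n^δ} ‖f ∘ T^{j r_n} - f‖²_{L²(ν)} → 0` as `n → ∞`. -/
def RigidityRate (T : X ≃ₜ X) (ν : Measure X) (f : C(X, ℂ)) (δ : ℝ) (r : ℕ → ℕ) : Prop :=
  Tendsto (fun n => ∑ j ∈ Finset.Icc (-⌊(r n : ℝ) ^ δ⌋) ⌊(r n : ℝ) ^ δ⌋,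
    ∫ x, ‖f ((T ^ (j * (r n : ℤ))) x) - f x‖ ^ 2 ∂ν) atTop (𝓝 0)

/-- `F` is linearly dense in `C(X)` (with the supremum norm, `X` being compact). -/
def IsLinearlyDense (F : Set C(X, ℂ)) : Prop :=
  Dense (Submodule.span ℂ F : Set C(X, ℂ))

/-- Polynomial rate of rigidity of `(X, T, ν)`. -/
def HasPRRigidity (T : X ≃ₜ X) (ν : Measure X) : Prop :=
  ∃ F : Set C(X, ℂ), IsLinearlyDense F ∧ ∀ f ∈ F, ∃ δ : ℝ, 0 < δ ∧
    ∃ r : ℕ → ℕ, StrictMono r ∧ (∀ n, 0 < r n) ∧ RigidityRate T ν f δ r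

/-- Polynomial rate of rigidity of `(X, T, ν)` with the prescribed rigidity times `r`, the same
for all functions in the linearly dense family. -/
def HasPRRigidityAlong (T : X ≃ₜ X) (ν : Measure X) (r : ℕ → ℕ) : Prop :=
  ∃ F : Set C(X, ℂ), IsLinearlyDense F ∧ ∀ f ∈ F, ∃ δ : ℝ, 0 < δ ∧
    RigidityRate T ν f δ r

end Rigidity

/-! Let `q` be a convergent denominator of `α` and `Q` the next one. The Birkhoff sums of `φ`, `η`,
`ψ` over `q` steps and the double Birkhoff sum of `φ` and `η` are controlled through their Fourier
series by small divisor sums over `n ≤ q / 2`, divided by `Q`, and by tails beyond `q / 2`. These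
are `O(q ^ (-ε / 5))` for infinitely many `q`: either `q ^ (2 + ε) ≤ Q` infinitely often, and
crude bounds suffice, or `α` is Diophantine with exponent `2 + ε`, and the small divisor sums with
weights `n ^ (-(2 + 2 * ε))` are bounded.

For such `q` the fibre part of `S ^ q` is, up to `O(q ^ (-ε / 10))` in the homogeneous gauge of the
Heisenberg group, a fixed central element with corner entry `β`. Central errors enter this gauge
through a square root, but it is subadditive, so errors of iterates just add up. By Dirichlet's
theorem some `v ≤ q ^ (ε / 16)` brings `v * β` close to an integer, and integer central elements
act trivially on the nilmanifold. Hence all `S ^ (j * v * q)` with `j` at most a small power of `q`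
are uniformly close to the identity on functions that are Lipschitz along translations, and these
form a dense subspace by the Stone–Weierstrass theorem. -/

/-! ### Exponential sums over a rotation -/

theorem exists_coe_eq_abs_eq_norm (y : UnitAddCircle) :
    ∃ t : ℝ, (t : UnitAddCircle) = y ∧ |t| = ‖y‖ := by
  obtain ⟨s, rfl⟩ := QuotientAddGroup.mk_surjective y
  refine ⟨s - round s, ?_, UnitAddCircle.norm_eq.symm⟩
  have : ((round s : ℝ) : UnitAddCircle) = 0 :=
    (AddCircle.coe_eq_zero_iff 1).2 ⟨round s, by simp⟩
  rw [AddCircle.coe_sub, this, sub_zero]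

theorem norm_coe_le_abs (t : ℝ) : ‖(t : UnitAddCircle)‖ ≤ |t| := by
  simpa [UnitAddCircle.norm_eq] using round_le t 0

theorem norm_le_one_half (y : UnitAddCircle) : ‖y‖ ≤ 1 / 2 := by
  simpa using AddCircle.norm_le_half_period (p := 1) (x := y) one_ne_zero

theorem norm_toCircle_coe_sub_one (t : ℝ) :
    ‖(AddCircle.toCircle (t : UnitAddCircle) : ℂ) - 1‖ = 2 * |Real.sin (Real.pi * t)| := by
  have : (AddCircle.toCircle (t : UnitAddCircle) : ℂ) =
      Complex.exp (Complex.I * ((2 * Real.pi * t : ℝ) : ℂ)) := by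
    rw [AddCircle.toCircle_apply_mk, Circle.coe_exp]
    congr 1
    push_cast
    ring
  rw [this, Complex.norm_exp_I_mul_ofReal_sub_one, Real.norm_eq_abs, abs_mul, abs_two]
  congr 3
  ring

theorem four_mul_norm_le_norm_toCircle_sub_one (y : UnitAddCircle) :
    4 * ‖y‖ ≤ ‖(y.toCircle : ℂ) - 1‖ := by
  obtain ⟨t, rfl, ht⟩ := exists_coe_eq_abs_eq_norm y
  have ht_half : |t| ≤ 1 / 2 := ht ▸ norm_le_one_half _
  have hjordan := Real.mul_abs_le_abs_sin (x := Real.pi * t) (by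
    rw [abs_mul, abs_of_pos Real.pi_pos]; nlinarith [Real.pi_pos])
  have : 2 / Real.pi * |Real.pi * t| = 2 * |t| := by
    rw [abs_mul, abs_of_pos Real.pi_pos]
    field_simp
  rw [norm_toCircle_coe_sub_one, ← ht]
  linarith

theorem norm_toCircle_sub_one_le (y : UnitAddCircle) : ‖(y.toCircle : ℂ) - 1‖ ≤ 8 * ‖y‖ := by
  obtain ⟨t, rfl, ht⟩ := exists_coe_eq_abs_eq_norm y
  have h := Real.abs_sin_le_abs (x := Real.pi * t)
  rw [abs_mul, abs_of_pos Real.pi_pos] at h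
  rw [norm_toCircle_coe_sub_one, ← ht]
  nlinarith [Real.pi_lt_four, abs_nonneg t]

theorem norm_fourier_apply (n : ℤ) (x : UnitAddCircle) : ‖fourier n x‖ = 1 :=
  Circle.norm_coe _

theorem norm_geom_sum_le {u : ℂ} (hu : ‖u‖ = 1) (q : ℕ) :
    ‖∑ j ∈ Finset.range q, u ^ j‖ ≤ q :=
  (norm_sum_le _ _).trans (by simp [hu])

theorem norm_sub_one_mul_norm_geom_sum (u : ℂ) (q : ℕ) :
    ‖u - 1‖ * ‖∑ j ∈ Finset.range q, u ^ j‖ = ‖u ^ q - 1‖ := by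
  rw [← norm_mul, mul_comm, geom_sum_mul]

/-- The iterated geometric sum `∑_{i < j < q} u ^ i * w ^ j`, through which a double ergodic sum
acts on a pair of Fourier modes. -/
noncomputable def doubleGeom (u w : ℂ) (q : ℕ) : ℂ :=
  ∑ j ∈ Finset.range q, ∑ i ∈ Finset.range j, u ^ i * w ^ j

theorem norm_doubleGeom_le {u w : ℂ} (hu : ‖u‖ = 1) (hw : ‖w‖ = 1) (q : ℕ) :
    ‖doubleGeom u w q‖ ≤ q * q := by
  refine (norm_sum_le_of_le _ (n := fun _ => (q : ℝ)) fun j hj => ?_).trans_eq (by simp)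
  rw [← Finset.sum_mul, norm_mul, norm_pow, hw, one_pow, mul_one]
  exact (norm_geom_sum_le hu j).trans (by exact_mod_cast (Finset.mem_range.1 hj).le)

theorem sub_one_mul_doubleGeom (u w : ℂ) (q : ℕ) :
    (u - 1) * doubleGeom u w q =
      (∑ j ∈ Finset.range q, (u * w) ^ j) - ∑ j ∈ Finset.range q, w ^ j := by
  rw [doubleGeom, Finset.mul_sum, ← Finset.sum_sub_distrib]
  refine Finset.sum_congr rfl fun j _ => ?_
  rw [← Finset.sum_mul, ← mul_assoc, mul_comm (u - 1), geom_sum_mul, mul_pow]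
  ring

-- The reflection `(i, j) ↦ (q - 1 - j, q - 1 - i)` exchanges the roles of `u` and `w`.
theorem doubleGeom_eq_mul_star {u w : ℂ} (hu : ‖u‖ = 1) (hw : ‖w‖ = 1) (q : ℕ) :
    doubleGeom u w q = (u * w) ^ (q - 1) * star (doubleGeom w u q) := by
  have hinv : ∀ {z : ℂ}, ‖z‖ = 1 → ∀ {m n : ℕ}, m ≤ n → z ^ (n - m) = z ^ n * star (z ^ m) := by
    intro z hz m n hmn
    have hz' : z ^ m * star (z ^ m) = 1 := by
      rw [Complex.star_def, Complex.mul_conj', norm_pow, hz]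
      simp
    rw [← Nat.sub_add_cancel hmn, pow_add, Nat.add_sub_cancel, mul_assoc, hz', mul_one]
  simp only [doubleGeom, star_sum, Finset.mul_sum]
  rw [Finset.sum_sigma', Finset.sum_sigma']
  refine Finset.sum_nbij' (fun p => ⟨q - 1 - p.2, q - 1 - p.1⟩)
    (fun p => ⟨q - 1 - p.2, q - 1 - p.1⟩)
    ?_ ?_ ?_ ?_ ?_
  · simp only [Finset.mem_sigma, Finset.mem_range]; omega
  · simp only [Finset.mem_sigma, Finset.mem_range]; omega
  · rintro ⟨j, i⟩ h
    simp only [Finset.mem_sigma, Finset.mem_range] at h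
    simp only [Sigma.mk.injEq, heq_eq_eq]
    omega
  · rintro ⟨j, i⟩ h
    simp only [Finset.mem_sigma, Finset.mem_range] at h
    simp only [Sigma.mk.injEq, heq_eq_eq]
    omega
  · rintro ⟨j, i⟩ h
    simp only [Finset.mem_sigma, Finset.mem_range] at h
    have hi : i = q - 1 - (q - 1 - i) := by omega
    have hj : j = q - 1 - (q - 1 - j) := by omega
    conv_lhs => rw [hi, hj, hinv hu (Nat.sub_le _ _), hinv hw (Nat.sub_le _ _)]
    rw [mul_pow, star_mul]
    ring

theorem norm_doubleGeom_comm {u w : ℂ} (hu : ‖u‖ = 1) (hw : ‖w‖ = 1) (q : ℕ) :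
    ‖doubleGeom u w q‖ = ‖doubleGeom w u q‖ := by
  rw [doubleGeom_eq_mul_star hu hw, norm_mul, norm_pow, norm_mul, hu, hw, norm_star]
  simp

/-- The exponential sum `∑_{j < q} e(n j x)`. -/
noncomputable def expSum (x : UnitAddCircle) (q : ℕ) (n : ℤ) : ℂ :=
  ∑ j ∈ Finset.range q, fourier n x ^ j

theorem norm_zsmul_mul_norm_expSum_le (x : UnitAddCircle) (q : ℕ) (n : ℤ) :
    4 * (‖n • x‖ * ‖expSum x q n‖) ≤ ‖fourier n x ^ q - 1‖ := by
  rw [expSum, ← norm_sub_one_mul_norm_geom_sum, ← mul_assoc]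
  gcongr
  exact four_mul_norm_le_norm_toCircle_sub_one _

theorem norm_expSum_le_of_norm_nsmul_le {x : UnitAddCircle} {q : ℕ} {n : ℤ} {Q : ℝ}
    (hq : ‖q • x‖ ≤ 1 / Q) (hn : n • x ≠ 0) :
    ‖expSum x q n‖ ≤ 2 * |(n : ℝ)| / (Q * ‖n • x‖) := by
  have hpow : fourier n x ^ q = ((n • (q • x)).toCircle : ℂ) := by
    rw [fourier_apply, smul_comm, AddCircle.toCircle_nsmul, Circle.coe_pow]
  have hdist : ‖n • (q • x)‖ ≤ |(n : ℝ)| * (1 / Q) := by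
    refine (norm_zsmul_le n (q • x)).trans ?_
    rw [Int.norm_eq_abs]
    gcongr
  have h := (norm_zsmul_mul_norm_expSum_le x q n).trans
    (hpow ▸ norm_toCircle_sub_one_le (n • (q • x)))
  rw [← div_div, le_div_iff₀ (norm_pos_iff.2 hn), mul_comm, mul_div_assoc, div_eq_mul_one_div]
  linarith

/-- The majorant `min (q, 1 / ‖n x‖)` of exponential sums of length `q`, written so that its value
at `n x = 0` is `q`. -/
noncomputable def majorant (x : UnitAddCircle) (q : ℕ) (n : ℤ) : ℝ :=
  q / max 1 (q * ‖n • x‖)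

section majorant

variable (x : UnitAddCircle) (q : ℕ) (n : ℤ)

theorem majorant_nonneg : 0 ≤ majorant x q n :=
  div_nonneg q.cast_nonneg (zero_le_one.trans (le_max_left _ _))

theorem majorant_le : majorant x q n ≤ q :=
  div_le_self q.cast_nonneg (le_max_left _ _)

theorem norm_zsmul_mul_majorant_le_one : ‖n • x‖ * majorant x q n ≤ 1 := by
  rw [majorant, mul_div_left_comm, ← mul_div_assoc]
  exact div_le_one_of_le₀ (le_max_right _ _) (zero_le_one.trans (le_max_left _ _))

theorem majorant_neg : majorant x q (-n) = majorant x q n := by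
  simp [majorant]

variable {x q n}

theorem le_majorant {B : ℝ} (hB : B ≤ q) (hBn : ‖n • x‖ * B ≤ 1) : B ≤ majorant x q n := by
  rw [majorant, le_div_iff₀ (lt_max_of_lt_left one_pos)]
  rcases max_cases (1 : ℝ) (q * ‖n • x‖) with ⟨h, -⟩ | ⟨h, -⟩ <;> rw [h]
  · rwa [mul_one]
  · nlinarith [(q.cast_nonneg : (0 : ℝ) ≤ q)]

end majorant

theorem norm_expSum_le_majorant (x : UnitAddCircle) (q : ℕ) (n : ℤ) :
    ‖expSum x q n‖ ≤ majorant x q n := by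
  have hu := norm_fourier_apply n x
  refine le_majorant (norm_geom_sum_le hu q) ?_
  have : ‖fourier n x ^ q - 1‖ ≤ 2 := by
    refine (norm_sub_le _ _).trans ?_
    rw [norm_pow, hu]
    norm_num
  linarith [norm_zsmul_mul_norm_expSum_le x q n]

theorem norm_zsmul_mul_norm_doubleGeom_le (x : UnitAddCircle) (q : ℕ) (k l : ℤ) :
    4 * (‖k • x‖ * ‖doubleGeom (fourier k x) (fourier l x) q‖) ≤
      ‖expSum x q (k + l)‖ + ‖expSum x q l‖ := by
  calc 4 * (‖k • x‖ * ‖doubleGeom (fourier k x) (fourier l x) q‖)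
      ≤ ‖(fourier k x : ℂ) - 1‖ * ‖doubleGeom (fourier k x) (fourier l x) q‖ := by
        rw [← mul_assoc]
        gcongr
        exact four_mul_norm_le_norm_toCircle_sub_one _
    _ = ‖expSum x q (k + l) - expSum x q l‖ := by
        rw [← norm_mul, sub_one_mul_doubleGeom]
        simp only [expSum, fourier_add]
    _ ≤ _ := norm_sub_le _ _

theorem norm_doubleGeom_le_majorant (x : UnitAddCircle) (q : ℕ) (k l : ℤ) :
    ‖doubleGeom (fourier k x) (fourier l x) q‖ ≤ q * majorant x q k := by
  rcases q.eq_zero_or_pos with rfl | hq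
  · simp [doubleGeom]
  have hq' : (0 : ℝ) < q := by exact_mod_cast hq
  rw [← div_le_iff₀' hq']
  refine le_majorant ?_ ?_
  · rw [div_le_iff₀ hq']
    exact norm_doubleGeom_le (norm_fourier_apply k x) (norm_fourier_apply l x) q
  · rw [← mul_div_assoc, div_le_one hq']
    have hsum := norm_zsmul_mul_norm_doubleGeom_le x q k l
    have hkl := (norm_expSum_le_majorant x q (k + l)).trans (majorant_le _ _ _)
    have hl := (norm_expSum_le_majorant x q l).trans (majorant_le _ _ _)
    linarith

/-! ### Sums over separated points -/

theorem one_add_log_le {l y : ℝ} (hl : 0 < l) (hy : 1 ≤ y) :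
    1 + Real.log y ≤ (1 + 1 / l) * y ^ l := by
  have hlog := Real.log_le_rpow_div (zero_le_one.trans hy) hl
  have hpow := Real.one_le_rpow hy hl.le
  rw [add_mul, one_mul, one_div_mul_eq_div]
  exact add_le_add hpow hlog

theorem injOn_natFloor_div {ι : Type*} {s : Set ι} {a : ι → ℝ} {δ : ℝ} (hδ : 0 < δ)
    (ha : ∀ i ∈ s, 0 ≤ a i) (hsep : s.Pairwise fun i j => δ ≤ |a i - a j|) :
    Set.InjOn (fun i => ⌊a i / δ⌋₊) s := by
  intro i hi j hj (hij : ⌊a i / δ⌋₊ = ⌊a j / δ⌋₊)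
  by_contra hne
  have hfloor : ⌊a i / δ⌋ = ⌊a j / δ⌋ := by
    rw [← Int.natCast_floor_eq_floor (div_nonneg (ha i hi) hδ.le),
      ← Int.natCast_floor_eq_floor (div_nonneg (ha j hj) hδ.le), hij]
  have hlt := Int.abs_sub_lt_one_of_floor_eq_floor hfloor
  rw [← sub_div, abs_div, abs_of_pos hδ, div_lt_one hδ] at hlt
  exact hlt.not_ge (hsep hi hj hne)

section Separated

variable {ι : Type*} {s : Finset ι} {f : ι → ℝ} {δ : ℝ}

theorem sum_le_of_separated_nonneg {a : ι → ℝ} (hδ : 0 < δ) (hδ' : δ ≤ 1 / 2)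
    (ha : ∀ i ∈ s, 0 ≤ a i) (ha' : ∀ i ∈ s, a i ≤ 1 / 2) (hf : ∀ i ∈ s, 0 ≤ f i)
    (hfδ : ∀ i ∈ s, f i ≤ δ⁻¹) (hfa : ∀ i ∈ s, a i * f i ≤ 1)
    (hsep : (s : Set ι).Pairwise fun i j => δ ≤ |a i - a j|) :
    ∑ i ∈ s, f i ≤ 2 * δ⁻¹ * (1 + Real.log δ⁻¹) := by
  classical
  have hterm : ∀ i ∈ s, f i ≤ 2 * δ⁻¹ * ((⌊a i / δ⌋₊ + 1 : ℕ) : ℝ)⁻¹ := by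
    intro i hi
    rw [← div_eq_mul_inv, le_div_iff₀ (by positivity), Nat.cast_succ, mul_add_one]
    have hfloor := Nat.floor_le (div_nonneg (ha i hi) hδ.le)
    calc f i * ⌊a i / δ⌋₊ + f i ≤ f i * (a i / δ) + δ⁻¹ := by
          gcongr
          exacts [hf i hi, hfδ i hi]
      _ = a i * f i * δ⁻¹ + δ⁻¹ := by ring
      _ ≤ 1 * δ⁻¹ + δ⁻¹ := by gcongr; exact hfa i hi
      _ = 2 * δ⁻¹ := by ring
  have hlt : ∀ i ∈ s, ⌊a i / δ⌋₊ < ⌊δ⁻¹⌋₊ := by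
    intro i hi
    have hdiv : a i / δ + 1 ≤ δ⁻¹ := by
      rw [inv_eq_one_div, le_div_iff₀ hδ, add_mul, div_mul_cancel₀ _ hδ.ne']
      linarith [ha' i hi]
    have := Nat.floor_mono hdiv
    rw [Nat.floor_add_one (div_nonneg (ha i hi) hδ.le)] at this
    omega
  calc ∑ i ∈ s, f i ≤ ∑ i ∈ s, 2 * δ⁻¹ * ((⌊a i / δ⌋₊ + 1 : ℕ) : ℝ)⁻¹ := Finset.sum_le_sum hterm
    _ = ∑ k ∈ s.image fun i => ⌊a i / δ⌋₊, 2 * δ⁻¹ * ((k + 1 : ℕ) : ℝ)⁻¹ :=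
        (Finset.sum_image (f := fun k : ℕ => 2 * δ⁻¹ * ((k + 1 : ℕ) : ℝ)⁻¹)
          (injOn_natFloor_div hδ ha hsep)).symm
    _ ≤ ∑ k ∈ Finset.range ⌊δ⁻¹⌋₊, 2 * δ⁻¹ * ((k + 1 : ℕ) : ℝ)⁻¹ := by
        refine Finset.sum_le_sum_of_subset_of_nonneg (fun k hk => ?_) fun _ _ _ => by positivity
        obtain ⟨i, hi, rfl⟩ := Finset.mem_image.1 hk
        exact Finset.mem_range.2 (hlt i hi)
    _ = 2 * δ⁻¹ * harmonic ⌊δ⁻¹⌋₊ := by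
        rw [← Finset.mul_sum, harmonic]
        push_cast
        rfl
    _ ≤ 2 * δ⁻¹ * (1 + Real.log δ⁻¹) := by
        gcongr
        exact harmonic_floor_le_one_add_log _ ((one_le_inv₀ hδ).2 (by linarith))

theorem sum_le_of_separated {y : ι → UnitAddCircle} {l : ℝ} (hl : 0 < l) (hδ : 0 < δ)
    (hδ' : δ ≤ 1 / 2) (hf : ∀ i ∈ s, 0 ≤ f i) (hfδ : ∀ i ∈ s, f i ≤ δ⁻¹)
    (hfy : ∀ i ∈ s, ‖y i‖ * f i ≤ 1) (hsep : (s : Set ι).Pairwise fun i j => δ ≤ ‖y i - y j‖) :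
    ∑ i ∈ s, f i ≤ 4 * (1 + 1 / l) * δ⁻¹ ^ (1 + l) := by
  choose t hty ht using fun i => exists_coe_eq_abs_eq_norm (y i)
  have ht_half : ∀ i, |t i| ≤ 1 / 2 := fun i => ht i ▸ norm_le_one_half _
  have ht_sep : (s : Set ι).Pairwise fun i j => δ ≤ |t i - t j| := fun i hi j hj hij =>
    (hsep hi hj hij).trans (by rw [← hty i, ← hty j, ← AddCircle.coe_sub]; exact norm_coe_le_abs _)
  have hclass : ∀ u ⊆ s, ∀ σ : ℝ, |σ| = 1 → (∀ i ∈ u, 0 ≤ σ * t i) →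
      ∑ i ∈ u, f i ≤ 2 * δ⁻¹ * (1 + Real.log δ⁻¹) := by
    intro u hu σ hσ hsign
    have habs : ∀ i ∈ u, σ * t i = ‖y i‖ := fun i hi => by
      rw [← abs_of_nonneg (hsign i hi), abs_mul, hσ, one_mul, ht]
    refine sum_le_of_separated_nonneg hδ hδ' hsign (fun i _ => ?_) (fun i hi => hf i (hu hi))
      (fun i hi => hfδ i (hu hi)) (fun i hi => ?_) fun i hi j hj hij => ?_
    · exact (le_abs_self _).trans (by rw [abs_mul, hσ, one_mul]; exact ht_half i)
    · rw [habs i hi]; exact hfy i (hu hi)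
    · change δ ≤ |σ * t i - σ * t j|
      rw [← mul_sub, abs_mul, hσ, one_mul]
      exact ht_sep (hu hi) (hu hj) hij
  have hpos := hclass (s.filter fun i => 0 ≤ t i) (Finset.filter_subset _ _) 1 (by simp)
    fun i hi => by simpa using (Finset.mem_filter.1 hi).2
  have hneg := hclass (s.filter fun i => ¬0 ≤ t i) (Finset.filter_subset _ _) (-1) (by simp)
    fun i hi => by simpa using (not_le.1 (Finset.mem_filter.1 hi).2).le
  calc ∑ i ∈ s, f i ≤ 4 * δ⁻¹ * (1 + Real.log δ⁻¹) := by
        rw [← Finset.sum_filter_add_sum_filter_not s (fun i => 0 ≤ t i)]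
        linarith
    _ ≤ 4 * δ⁻¹ * ((1 + 1 / l) * δ⁻¹ ^ l) := by
        gcongr
        exact one_add_log_le hl ((one_le_inv₀ hδ).2 (by linarith))
    _ = 4 * (1 + 1 / l) * δ⁻¹ ^ (1 + l) := by
        rw [Real.rpow_add (inv_pos.2 hδ), Real.rpow_one]
        ring

end Separated

/-- The first `M` multiples of `x` have distance at least `δ` from `0`; equivalently, any `M + 1`
consecutive multiples of `x` are `δ`-separated. -/
def IsSpaced (x : UnitAddCircle) (M : ℕ) (δ : ℝ) : Prop :=
  ∀ n ∈ Finset.Icc 1 M, δ ≤ ‖n • x‖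

/-- The spacing of the multiples of `x` produced by a convergent of `x` with denominator `q`. -/
abbrev WellSpaced (x : UnitAddCircle) (q : ℕ) : Prop :=
  IsSpaced x (q / 2) (2 * (q : ℝ))⁻¹

namespace IsSpaced

variable {x : UnitAddCircle} {M : ℕ} {δ : ℝ}

theorem le_norm_zsmul (h : IsSpaced x M δ) {n : ℤ} (hn : n ≠ 0) (hnM : |n| ≤ M) :
    δ ≤ ‖n • x‖ := by
  rw [Int.abs_eq_natAbs] at hnM
  rw [← norm_natAbs_smul]
  exact h _ (Finset.mem_Icc.2 ⟨Int.natAbs_pos.2 hn, by exact_mod_cast hnM⟩)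

theorem le_norm_sub (h : IsSpaced x M δ) {m n : ℤ} (hmn : m ≠ n) (hM : |m - n| ≤ M) :
    δ ≤ ‖m • x - n • x‖ := by
  rw [← sub_smul]
  exact h.le_norm_zsmul (sub_ne_zero.2 hmn) hM

theorem sum_inv_norm_le (h : IsSpaced x M δ) (hδ : 0 < δ) (hδ' : δ ≤ 1 / 2) {l : ℝ} (hl : 0 < l) :
    ∑ n ∈ Finset.Icc 1 M, ‖n • x‖⁻¹ ≤ 4 * (1 + 1 / l) * δ⁻¹ ^ (1 + l) := by
  refine sum_le_of_separated (y := fun n => n • x) hl hδ hδ' (fun n _ => by positivity)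
    (fun n hn => inv_anti₀ hδ (h n hn)) (fun n _ => mul_inv_le_one) fun m hm n hn hmn => ?_
  simp only [Finset.coe_Icc, Set.mem_Icc] at hm hn
  have := h.le_norm_sub (m := m) (n := n) (by exact_mod_cast hmn) (by rw [abs_le]; omega)
  simpa only [natCast_zsmul] using this

theorem sum_majorant_le (h : IsSpaced x M δ) (hδ : 0 < δ) (hδ' : δ ≤ 1 / 2) {q : ℕ}
    (hq : q ≤ δ⁻¹) {l : ℝ} (hl : 0 < l) (a : ℤ) :
    ∑ i ∈ Finset.range (M + 1), majorant x q (a + i) ≤ 4 * (1 + 1 / l) * δ⁻¹ ^ (1 + l) := by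
  refine sum_le_of_separated (s := Finset.range (M + 1)) (y := fun i : ℕ => (a + i : ℤ) • x) hl hδ
    hδ' (fun i _ => majorant_nonneg _ _ _) (fun i _ => (majorant_le _ _ _).trans hq)
    (fun i _ => norm_zsmul_mul_majorant_le_one _ _ _) fun i hi j hj hij => ?_
  simp only [Finset.coe_range, Set.mem_Iio] at hi hj
  exact h.le_norm_sub (by omega) (by rw [abs_le]; omega)

end IsSpaced

theorem inv_two_mul_le_one_half {q : ℕ} (hq : 1 ≤ q) : (2 * (q : ℝ))⁻¹ ≤ 1 / 2 := by
  rw [one_div]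
  exact inv_anti₀ two_pos (by linarith [(Nat.one_le_cast (α := ℝ)).2 hq])

/-! ### Tails beyond half the denominator -/

theorem tsum_int_le_of_even {f : ℤ → ℝ} (h0 : 0 ≤ f 0) (heven : f.Even) (hf : Summable f) :
    ∑' n, f n ≤ 2 * ∑' n : ℕ, f n := by
  have hnat : Summable fun n : ℕ => f n := hf.comp_injective Nat.cast_injective
  rw [hnat.tsum_of_nat_of_neg (by simpa only [heven _] using hnat)]
  simp only [heven _]
  linarith

theorem sum_range_mul_le {f g : ℕ → ℝ} {L : ℕ}
    (h : ∀ b, ∑ i ∈ Finset.range L, f (L * b + i) ≤ g b) (M : ℕ) :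
    ∑ n ∈ Finset.range (L * M), f n ≤ ∑ b ∈ Finset.range M, g b := by
  induction M with
  | zero => simp
  | succ M ih =>
    rw [mul_add_one, Finset.sum_range_add, Finset.sum_range_succ]
    exact add_le_add ih (h M)

theorem tsum_rpow_mul_le_of_block_le {f : ℕ → ℝ} {L : ℕ} {s B : ℝ} (hL : 0 < L) (hs : 1 < s)
    (hf : ∀ n, 0 ≤ f n) (hB : 0 ≤ B) (hblock : ∀ b, ∑ i ∈ Finset.range L, f (L * b + i) ≤ B) :
    ∑' n : ℕ, (if L ≤ n then (n : ℝ) ^ (-s) * f n else 0) ≤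
      (∑' n : ℕ, (n : ℝ) ^ (-s)) * ((L : ℝ) ^ (-s) * B) := by
  set g : ℕ → ℝ := fun n => if L ≤ n then (n : ℝ) ^ (-s) * f n else 0 with hg
  have hg0 : ∀ n, 0 ≤ g n := fun n => by
    have := hf n
    simp only [hg]
    split_ifs <;> positivity
  have hgblock : ∀ b, ∑ i ∈ Finset.range L, g (L * b + i) ≤
      (b : ℝ) ^ (-s) * ((L : ℝ) ^ (-s) * B) := by
    intro b
    rcases b.eq_zero_or_pos with rfl | hb
    · refine (Finset.sum_nonpos fun i hi => ?_).trans (by positivity)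
      rw [Finset.mem_range] at hi
      simp [hg, hi.not_ge]
    calc ∑ i ∈ Finset.range L, g (L * b + i)
        ≤ ∑ i ∈ Finset.range L, ((L * b : ℕ) : ℝ) ^ (-s) * f (L * b + i) := by
          refine Finset.sum_le_sum fun i _ => ?_
          simp only [hg, if_pos (show L ≤ L * b + i by nlinarith)]
          refine mul_le_mul_of_nonneg_right ?_ (hf _)
          exact Real.rpow_le_rpow_of_nonpos (by positivity) (by push_cast; linarith) (by linarith)
      _ ≤ ((L * b : ℕ) : ℝ) ^ (-s) * B := by
          rw [← Finset.mul_sum]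
          gcongr
          exact hblock b
      _ = (b : ℝ) ^ (-s) * ((L : ℝ) ^ (-s) * B) := by
          rw [Nat.cast_mul, Real.mul_rpow (by positivity) (by positivity)]
          ring
  refine Real.tsum_le_of_sum_range_le hg0 fun M => ?_
  calc ∑ n ∈ Finset.range M, g n ≤ ∑ n ∈ Finset.range (L * M), g n :=
        Finset.sum_le_sum_of_subset_of_nonneg
          (Finset.range_mono (Nat.le_mul_of_pos_left M hL)) fun n _ _ => hg0 n
    _ ≤ ∑ b ∈ Finset.range M, (b : ℝ) ^ (-s) * ((L : ℝ) ^ (-s) * B) := sum_range_mul_le hgblock M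
    _ ≤ _ := by
        rw [← Finset.sum_mul]
        gcongr
        exact (Real.summable_nat_rpow.2 (by linarith)).sum_le_tsum _ fun n _ => by positivity

/-- The term `|n| ^ (-s) * majorant x q n`, restricted to the tail `2 * |n| > q`. -/
noncomputable def tailTerm (x : UnitAddCircle) (q : ℕ) (s : ℝ) (n : ℤ) : ℝ :=
  if (q : ℤ) < 2 * |n| then |(n : ℝ)| ^ (-s) * majorant x q n else 0

theorem tailTerm_nonneg (x : UnitAddCircle) (q : ℕ) (s : ℝ) (n : ℤ) : 0 ≤ tailTerm x q s n := by
  have := majorant_nonneg x q n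
  unfold tailTerm
  split_ifs <;> positivity

theorem tailTerm_le (x : UnitAddCircle) (q : ℕ) (s : ℝ) (n : ℤ) :
    tailTerm x q s n ≤ |(n : ℝ)| ^ (-s) * q := by
  have := majorant_le x q n
  unfold tailTerm
  split_ifs
  · gcongr
  · positivity

theorem summable_tailTerm (x : UnitAddCircle) (q : ℕ) {s : ℝ} (hs : 1 < s) :
    Summable (tailTerm x q s) :=
  .of_nonneg_of_le (tailTerm_nonneg x q s) (tailTerm_le x q s)
    ((Real.summable_abs_int_rpow hs).mul_right _)

theorem tailTerm_natCast (x : UnitAddCircle) (q : ℕ) (s : ℝ) (n : ℕ) :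
    tailTerm x q s n = if q / 2 + 1 ≤ n then (n : ℝ) ^ (-s) * majorant x q n else 0 := by
  unfold tailTerm
  rw [Nat.abs_cast, Int.cast_natCast, Nat.abs_cast]
  exact if_congr (by omega) rfl rfl

theorem exists_tsum_tailTerm_le {s l : ℝ} (hs : 1 < s) (hl : 0 < l) :
    ∃ C : ℝ, 0 ≤ C ∧ ∀ (x : UnitAddCircle) (q : ℕ), 1 ≤ q → WellSpaced x q →
      ∑' n, tailTerm x q s n ≤ C * (q : ℝ) ^ (1 - s + l) := by
  set ζ : ℝ := ∑' n : ℕ, (n : ℝ) ^ (-s)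
  have : 0 ≤ ζ := tsum_nonneg fun n => by positivity
  refine ⟨2 * (ζ * (2 ^ s * (4 * (1 + 1 / l) * 2 ^ (1 + l)))), by positivity, fun x q hq h => ?_⟩
  have hq' : (1 : ℝ) ≤ q := by exact_mod_cast hq
  set L : ℕ := q / 2 + 1
  have hL : (q : ℝ) / 2 ≤ L := by
    rw [div_le_iff₀ two_pos]
    exact_mod_cast (by omega : q ≤ L * 2)
  have hLs : (L : ℝ) ^ (-s) ≤ 2 ^ s * (q : ℝ) ^ (-s) := by
    refine (Real.rpow_le_rpow_of_nonpos (by positivity) hL (by linarith)).trans_eq ?_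
    rw [Real.div_rpow (by positivity) two_pos.le, Real.rpow_neg two_pos.le, div_inv_eq_mul,
      mul_comm]
  have hblock : ∀ b : ℕ, ∑ i ∈ Finset.range L, majorant x q ((L * b + i : ℕ) : ℤ) ≤
      4 * (1 + 1 / l) * (2 * q) ^ (1 + l) := by
    intro b
    have := h.sum_majorant_le (by positivity) (inv_two_mul_le_one_half hq) (q := q)
      (by rw [inv_inv]; linarith) hl ((L * b : ℕ) : ℤ)
    simpa only [inv_inv, ← Nat.cast_add] using this
  have hnat : ∑' n : ℕ, tailTerm x q s n ≤
      ζ * ((L : ℝ) ^ (-s) * (4 * (1 + 1 / l) * (2 * q) ^ (1 + l))) := by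
    simp only [tailTerm_natCast]
    exact tsum_rpow_mul_le_of_block_le (f := fun n => majorant x q n) (by omega) hs
      (fun n => majorant_nonneg _ _ _) (by positivity) hblock
  calc ∑' n, tailTerm x q s n
      ≤ 2 * ∑' n : ℕ, tailTerm x q s n :=
        tsum_int_le_of_even (tailTerm_nonneg _ _ _ _) (fun n => by simp [tailTerm, majorant_neg])
          (summable_tailTerm x q hs)
    _ ≤ 2 * (ζ * ((2 ^ s * (q : ℝ) ^ (-s)) * (4 * (1 + 1 / l) * (2 * q) ^ (1 + l)))) := by
        refine mul_le_mul_of_nonneg_left (hnat.trans ?_) two_pos.le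
        gcongr
    _ = _ := by
        rw [Real.mul_rpow two_pos.le (by positivity), show 1 - s + l = -s + (1 + l) by ring,
          Real.rpow_add (by positivity) (-s)]
        ring

/-! ### Sums over half the denominator -/

/-- The weighted sum of the inverse distances of the multiples `n • x`, `1 ≤ n ≤ q / 2`, from `0`.
These are the small divisors of an exponential sum of length `q`. -/
noncomputable def headSum (x : UnitAddCircle) (q : ℕ) (p : ℝ) : ℝ :=
  ∑ n ∈ Finset.Icc 1 (q / 2), (n : ℝ) ^ (-p) * ‖n • x‖⁻¹

theorem headSum_nonneg (x : UnitAddCircle) (q : ℕ) (p : ℝ) : 0 ≤ headSum x q p :=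
  Finset.sum_nonneg fun n _ => by positivity

theorem headSum_anti (x : UnitAddCircle) (q : ℕ) : Antitone (headSum x q) := by
  intro p p' h
  refine Finset.sum_le_sum fun n hn => ?_
  have : (1 : ℝ) ≤ n := by exact_mod_cast (Finset.mem_Icc.1 hn).1
  gcongr

theorem exists_headSum_le {l : ℝ} (hl : 0 < l) :
    ∃ K : ℝ, 0 ≤ K ∧ ∀ (x : UnitAddCircle) (q : ℕ) (p : ℝ), 1 ≤ q → WellSpaced x q → 0 ≤ p →
      headSum x q p ≤ K * (q : ℝ) ^ (1 + l) := by
  refine ⟨4 * (1 + 1 / l) * 2 ^ (1 + l), by positivity, fun x q p hq hw hp => ?_⟩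
  have : (1 : ℝ) ≤ q := by exact_mod_cast hq
  calc headSum x q p ≤ headSum x q 0 := headSum_anti x q hp
    _ = ∑ n ∈ Finset.Icc 1 (q / 2), ‖n • x‖⁻¹ := by
      simp only [headSum, neg_zero, Real.rpow_zero, one_mul]
    _ ≤ 4 * (1 + 1 / l) * (2 * (q : ℝ))⁻¹⁻¹ ^ (1 + l) :=
      hw.sum_inv_norm_le (by positivity) (inv_two_mul_le_one_half hq) hl
    _ = _ := by rw [inv_inv, Real.mul_rpow two_pos.le (by positivity), ← mul_assoc]

theorem headSum_le_rpow_mul_add (x : UnitAddCircle) {q : ℕ} (hq : 1 ≤ q) {ε : ℝ} (hε : 0 ≤ ε) :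
    headSum x q ε ≤ (q : ℝ) ^ (-(ε / 4)) * headSum x q 0 +
      (q : ℝ) ^ ((2 + ε) / 4) * headSum x q (2 + 2 * ε) := by
  have : (1 : ℝ) ≤ q := by exact_mod_cast hq
  simp only [headSum, Finset.mul_sum, ← Finset.sum_add_distrib]
  refine Finset.sum_le_sum fun n hn => ?_
  have hn1 : (1 : ℝ) ≤ n := by exact_mod_cast (Finset.mem_Icc.1 hn).1
  rw [← mul_assoc, ← mul_assoc, ← add_mul, neg_zero, Real.rpow_zero, mul_one]
  refine mul_le_mul_of_nonneg_right ?_ (by positivity)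
  rcases le_total ((q : ℝ) ^ (1 / 4 : ℝ)) n with hqn | hqn
  · calc (n : ℝ) ^ (-ε) ≤ ((q : ℝ) ^ (1 / 4 : ℝ)) ^ (-ε) :=
          Real.rpow_le_rpow_of_nonpos (by positivity) hqn (by linarith)
      _ = (q : ℝ) ^ (-(ε / 4)) := by rw [← Real.rpow_mul (by positivity)]; ring_nf
      _ ≤ _ := le_add_of_nonneg_right (by positivity)
  · calc (n : ℝ) ^ (-ε) = (n : ℝ) ^ (2 + ε) * (n : ℝ) ^ (-(2 + 2 * ε)) := by
          rw [← Real.rpow_add (by positivity)]; ring_nf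
      _ ≤ ((q : ℝ) ^ (1 / 4 : ℝ)) ^ (2 + ε) * (n : ℝ) ^ (-(2 + 2 * ε)) := by gcongr
      _ = (q : ℝ) ^ ((2 + ε) / 4) * (n : ℝ) ^ (-(2 + 2 * ε)) := by
          rw [← Real.rpow_mul (by positivity)]; ring_nf
      _ ≤ _ := le_add_of_nonneg_left (by positivity)

/-- The term `|n| ^ (-p) / ‖n • x‖`, restricted to the head `2 * |n| ≤ q`. It vanishes at `n = 0`,
where the division is by `0`. -/
noncomputable def headTerm (x : UnitAddCircle) (q : ℕ) (p : ℝ) (n : ℤ) : ℝ :=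
  if 2 * |n| ≤ q then |(n : ℝ)| ^ (-p) / ‖n • x‖ else 0

theorem headTerm_nonneg (x : UnitAddCircle) (q : ℕ) (p : ℝ) (n : ℤ) : 0 ≤ headTerm x q p n := by
  unfold headTerm
  split_ifs <;> positivity

theorem summable_headTerm (x : UnitAddCircle) (q : ℕ) (p : ℝ) : Summable (headTerm x q p) :=
  summable_of_ne_finset_zero (s := Finset.Icc (-q : ℤ) q) fun n hn =>
    if_neg fun h => hn (Finset.mem_Icc.2 (abs_le.1 (by linarith [abs_nonneg n])))

theorem headTerm_neg (x : UnitAddCircle) (q : ℕ) (p : ℝ) (n : ℤ) :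
    headTerm x q p (-n) = headTerm x q p n := by
  simp only [headTerm, abs_neg, Int.cast_neg, neg_smul, norm_neg]

theorem tsum_headTerm_le (x : UnitAddCircle) (q : ℕ) (p : ℝ) :
    ∑' n, headTerm x q p n ≤ 2 * headSum x q p := by
  refine (tsum_int_le_of_even (headTerm_nonneg x q p 0) (headTerm_neg x q p)
    (summable_headTerm x q p)).trans_eq ?_
  rw [headSum, tsum_eq_sum (s := Finset.Icc 1 (q / 2))]
  · congr 1
    refine Finset.sum_congr rfl fun n hn => ?_
    have : 2 * |(n : ℤ)| ≤ q := by rw [Nat.abs_cast]; have := Finset.mem_Icc.1 hn; omega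
    rw [headTerm, if_pos this, div_eq_mul_inv, natCast_zsmul, Int.cast_natCast, Nat.abs_cast]
  · intro n hn
    rcases n.eq_zero_or_pos with rfl | hn0
    · simp [headTerm]
    · refine if_neg fun h => hn (Finset.mem_Icc.2 ⟨hn0, ?_⟩)
      rw [Nat.abs_cast] at h
      omega

theorem isSpaced_of_diophantine {x : UnitAddCircle} {c τ : ℝ} (hc : 0 ≤ c) (hτ : 0 ≤ τ)
    (hx : ∀ n : ℕ, 1 ≤ n → c * (n : ℝ) ^ (-τ) ≤ ‖n • x‖) (M : ℕ) :
    IsSpaced x M (c * (M : ℝ) ^ (-τ)) := by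
  intro n hn
  rw [Finset.mem_Icc] at hn
  have hn' : (0 : ℝ) < n := by exact_mod_cast hn.1
  refine le_trans (mul_le_mul_of_nonneg_left ?_ hc) (hx n hn.1)
  exact Real.rpow_le_rpow_of_nonpos hn' (by exact_mod_cast hn.2) (by linarith)

theorem isBigO_sum_inv_norm_of_diophantine {x : UnitAddCircle} {c τ : ℝ} (hc : 0 < c)
    (hτ : 0 ≤ τ) (hx : ∀ n : ℕ, 1 ≤ n → c * (n : ℝ) ^ (-τ) ≤ ‖n • x‖) {l : ℝ} (hl : 0 < l) :
    (fun M : ℕ => ∑ n ∈ Finset.Icc 1 M, ‖n • x‖⁻¹) =O[atTop]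
      fun M : ℕ => (M : ℝ) ^ (τ * (1 + l)) := by
  have hc' : c ≤ 1 / 2 := by simpa using (hx 1 le_rfl).trans (norm_le_one_half _)
  refine .of_bound (4 * (1 + 1 / l) * c⁻¹ ^ (1 + l)) ?_
  filter_upwards [eventually_ge_atTop 1] with M hM
  have hM' : (1 : ℝ) ≤ M := by exact_mod_cast hM
  have hp : (M : ℝ) ^ (-τ) ≤ 1 := Real.rpow_le_one_of_one_le_of_nonpos hM' (by linarith)
  rw [Real.norm_of_nonneg (Finset.sum_nonneg fun n _ => by positivity),
    Real.norm_of_nonneg (by positivity)]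
  refine ((isSpaced_of_diophantine hc.le hτ hx M).sum_inv_norm_le (by positivity)
    ((mul_le_of_le_one_right hc.le hp).trans hc') hl).trans_eq ?_
  rw [mul_inv, Real.rpow_neg (by positivity), inv_inv, Real.mul_rpow (by positivity)
    (by positivity), ← Real.rpow_mul (by positivity), ← mul_assoc]

theorem exists_headSum_le_of_diophantine {x : UnitAddCircle} {c τ p : ℝ} (hc : 0 < c)
    (hτ : 0 < τ) (hp : τ < p) (hx : ∀ n : ℕ, 1 ≤ n → c * (n : ℝ) ^ (-τ) ≤ ‖n • x‖) :
    ∃ G : ℝ, 0 ≤ G ∧ ∀ q : ℕ, headSum x q p ≤ G := by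
  set l : ℝ := (p - τ) / (2 * τ) with hl
  have hl0 : 0 < l := div_pos (by linarith) (by linarith)
  have hlp : τ * (1 + l) < p := by
    have : τ * l = (p - τ) / 2 := by rw [hl]; field_simp
    linarith
  have hsum := (LSeriesSummable_of_sum_norm_bigO_and_nonneg (s := (p : ℂ))
    (isBigO_sum_inv_norm_of_diophantine hc hτ.le hx hl0) (fun n => by positivity) (by positivity)
    (by rwa [Complex.ofReal_re])).norm
  refine ⟨_, tsum_nonneg fun n => norm_nonneg _, fun q =>
    (Finset.sum_congr rfl fun n hn => ?_).trans_le
      (hsum.sum_le_tsum (Finset.Icc 1 (q / 2)) fun n _ => norm_nonneg _)⟩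
  rw [LSeries.norm_term_eq, if_neg (by have := Finset.mem_Icc.1 hn; omega), Complex.norm_real,
    Complex.ofReal_re, norm_inv, norm_norm, Real.rpow_neg (by positivity), div_eq_inv_mul]

/-! ### Good denominators -/

/-- The properties of the denominator `q` of a convergent of `x`, and the denominator `Q` of the
next one, on which all estimates are based. -/
structure IsApproxDenominator (x : UnitAddCircle) (q : ℕ) (Q : ℝ) : Prop where
  one_le : 1 ≤ q
  le : q ≤ Q
  norm_nsmul_le : ‖q • x‖ ≤ 1 / Q
  wellSpaced : WellSpaced x q

/-- The denominator `q` is good if its small divisors are compensated by the quality `1 / Q` of the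
approximation, with a power of `q` to spare. -/
structure IsGoodDenominator (x : UnitAddCircle) (ε C : ℝ) (q : ℕ) (Q : ℝ) : Prop
    extends IsApproxDenominator x q Q where
  headSum_le : headSum x q ε ≤ C * (q : ℝ) ^ (-(ε / 5)) * Q
  headSum_mul_headSum_le :
    headSum x q (2 + 2 * ε) * headSum x q (1 + 2 * ε) ≤ C * (q : ℝ) ^ (-(ε / 5)) * Q

theorem IsApproxDenominator.one_le_cast {x : UnitAddCircle} {q : ℕ} {Q : ℝ}
    (h : IsApproxDenominator x q Q) : (1 : ℝ) ≤ q :=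
  Nat.one_le_cast.2 h.one_le

theorem exists_isGoodDenominator_of_rpow_le {ε : ℝ} (hε : 0 < ε) :
    ∃ C : ℝ, 0 ≤ C ∧ ∀ (x : UnitAddCircle) (q : ℕ) (Q : ℝ), IsApproxDenominator x q Q →
      (q : ℝ) ^ (2 + ε) ≤ Q → IsGoodDenominator x ε C q Q := by
  obtain ⟨K, hK, hhead⟩ := exists_headSum_le (l := ε / 4) (by linarith)
  refine ⟨K + K * K, by positivity, fun x q Q h hQ => ?_⟩
  have hq := h.one_le_cast
  have hpow : ∀ a ≤ 2 + ε / 2, (q : ℝ) ^ a ≤ (q : ℝ) ^ (-(ε / 5)) * Q := fun a ha =>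
    calc (q : ℝ) ^ a ≤ (q : ℝ) ^ (-(ε / 5) + (2 + ε)) :=
          Real.rpow_le_rpow_of_exponent_le hq (by linarith)
      _ = (q : ℝ) ^ (-(ε / 5)) * (q : ℝ) ^ (2 + ε) := Real.rpow_add (by positivity) _ _
      _ ≤ _ := by gcongr
  have : 0 ≤ Q := (by positivity : (0 : ℝ) ≤ q ^ (2 + ε)).trans hQ
  have hle : ∀ p, 0 ≤ p → headSum x q p ≤ K * (q : ℝ) ^ (1 + ε / 4) := fun p hp =>
    hhead x q p h.one_le h.wellSpaced hp
  refine ⟨h, ?_, ?_⟩ <;> rw [mul_assoc]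
  · calc headSum x q ε ≤ K * (q : ℝ) ^ (1 + ε / 4) := hle _ hε.le
      _ ≤ (K + K * K) * ((q : ℝ) ^ (-(ε / 5)) * Q) := by
        gcongr
        · exact le_add_of_nonneg_right (by positivity)
        · exact hpow _ (by linarith)
  · calc headSum x q (2 + 2 * ε) * headSum x q (1 + 2 * ε)
        ≤ (K * (q : ℝ) ^ (1 + ε / 4)) * (K * (q : ℝ) ^ (1 + ε / 4)) :=
          mul_le_mul (hle _ (by linarith)) (hle _ (by linarith)) (headSum_nonneg _ _ _)
            (by positivity)
      _ = (K * K) * (q : ℝ) ^ ((1 + ε / 4) + (1 + ε / 4)) := by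
          rw [Real.rpow_add (by positivity) (1 + ε / 4), mul_mul_mul_comm]
      _ ≤ (K + K * K) * ((q : ℝ) ^ (-(ε / 5)) * Q) := by
        gcongr
        · exact le_add_of_nonneg_left hK
        · exact hpow _ (by linarith)

theorem exists_isGoodDenominator_of_diophantine {x : UnitAddCircle} {c ε : ℝ} (hc : 0 < c)
    (hε : 0 < ε) (hε1 : ε ≤ 1) (hx : ∀ n : ℕ, 1 ≤ n → c * (n : ℝ) ^ (-(2 + ε)) ≤ ‖n • x‖) :
    ∃ C : ℝ, 0 ≤ C ∧ ∀ (q : ℕ) (Q : ℝ), IsApproxDenominator x q Q →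
      IsGoodDenominator x ε C q Q := by
  obtain ⟨G, hG, hbdd⟩ := exists_headSum_le_of_diophantine (p := 2 + 2 * ε) hc
    (by linarith) (by linarith) hx
  obtain ⟨K, hK, hhead⟩ := exists_headSum_le (l := ε / 20) (by linarith)
  refine ⟨(1 + G) * (K + G), by positivity, fun q Q h => ?_⟩
  have hq := h.one_le_cast
  have hQ := h.le
  have hsum : headSum x q ε ≤ (K + G) * (q : ℝ) ^ (-(ε / 5)) * Q :=
    calc headSum x q ε
        ≤ (q : ℝ) ^ (-(ε / 4)) * headSum x q 0 +
          (q : ℝ) ^ ((2 + ε) / 4) * headSum x q (2 + 2 * ε) :=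
          headSum_le_rpow_mul_add x h.one_le hε.le
      _ ≤ (q : ℝ) ^ (-(ε / 4)) * (K * (q : ℝ) ^ (1 + ε / 20)) +
          (q : ℝ) ^ (-(ε / 5) + 1) * G := by
        gcongr
        · exact hhead x q 0 h.one_le h.wellSpaced le_rfl
        · exact headSum_nonneg _ _ _
        · linarith
        · exact hbdd q
      _ = (K + G) * (q : ℝ) ^ (-(ε / 5) + 1) := by
        rw [mul_left_comm, ← Real.rpow_add (by positivity)]; ring_nf
      _ = (K + G) * (q : ℝ) ^ (-(ε / 5)) * q := by
        rw [Real.rpow_add_one (by positivity), mul_assoc]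
      _ ≤ _ := by gcongr
  refine ⟨h, hsum.trans ?_, ?_⟩
  · gcongr
    · linarith
    · exact le_mul_of_one_le_left (by positivity) (by linarith)
  · calc headSum x q (2 + 2 * ε) * headSum x q (1 + 2 * ε)
        ≤ (1 + G) * ((K + G) * (q : ℝ) ^ (-(ε / 5)) * Q) :=
          mul_le_mul ((hbdd q).trans (by linarith))
            ((headSum_anti x q (by linarith)).trans hsum) (headSum_nonneg _ _ _) (by positivity)
      _ = _ := by ring

theorem exists_diophantine_of_le_rpow {x : UnitAddCircle} {q : ℕ → ℕ}
    (hq : ∀ n, IsApproxDenominator x (q n) (q (n + 1))) (htop : Tendsto q atTop atTop) {τ : ℝ}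
    (hτ : 0 ≤ τ) (h : ∀ᶠ n in atTop, (q (n + 1) : ℝ) ≤ (q n : ℝ) ^ τ) :
    ∃ c : ℝ, 0 < c ∧ ∀ n : ℕ, 1 ≤ n → c * (n : ℝ) ^ (-τ) ≤ ‖n • x‖ := by
  obtain ⟨m₀, hm₀⟩ := eventually_atTop.1 h
  have hmono : Monotone q := monotone_nat_of_le_succ fun n => by exact_mod_cast (hq n).le
  have hq0 := (hq m₀).one_le_cast
  refine ⟨(2 * (q m₀ * (2 : ℝ) ^ τ))⁻¹, by positivity, fun n hn => ?_⟩
  have hn' : (1 : ℝ) ≤ n := by exact_mod_cast hn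
  -- The least `m` with `n ≤ q m / 2`: then `q (m - 1) < 2 * n`.
  obtain ⟨m, hm, hmin⟩ := Nat.findX (htop.eventually_ge_atTop (2 * n)).exists
  have hqm : (q m : ℝ) ≤ q m₀ * (2 * (n : ℝ)) ^ τ := by
    have h1 : 1 ≤ (2 * (n : ℝ)) ^ τ := Real.one_le_rpow (by linarith) hτ
    rcases le_or_gt m m₀ with hmm | hmm
    · have : (q m : ℝ) ≤ q m₀ := by exact_mod_cast hmono hmm
      exact this.trans (le_mul_of_one_le_right (by positivity) h1)
    · obtain ⟨k, rfl⟩ := Nat.exists_eq_add_of_lt hmm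
      have hk : (q (m₀ + k) : ℝ) ≤ 2 * n := by
        exact_mod_cast (not_le.1 (hmin (m₀ + k) (by omega))).le
      calc (q (m₀ + k + 1) : ℝ) ≤ (q (m₀ + k) : ℝ) ^ τ := hm₀ _ (by omega)
        _ ≤ (2 * (n : ℝ)) ^ τ := by gcongr
        _ ≤ _ := le_mul_of_one_le_left (by positivity) hq0
  have hqm0 := (hq m).one_le_cast
  calc (2 * (q m₀ * (2 : ℝ) ^ τ))⁻¹ * (n : ℝ) ^ (-τ) = (2 * (q m₀ * (2 * (n : ℝ)) ^ τ))⁻¹ := by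
        rw [Real.rpow_neg (by positivity), ← mul_inv, Real.mul_rpow two_pos.le (by positivity),
          mul_assoc, mul_assoc]
    _ ≤ (2 * (q m : ℝ))⁻¹ := by gcongr
    _ ≤ ‖n • x‖ := (hq m).wellSpaced n (Finset.mem_Icc.2 ⟨hn, by omega⟩)

theorem exists_frequently_isGoodDenominator {x : UnitAddCircle} {q : ℕ → ℕ}
    (hq : ∀ n, IsApproxDenominator x (q n) (q (n + 1))) (htop : Tendsto q atTop atTop) {ε : ℝ}
    (hε : 0 < ε) (hε1 : ε ≤ 1) :
    ∃ C : ℝ, 0 ≤ C ∧ ∃ᶠ n in atTop, IsGoodDenominator x ε C (q n) (q (n + 1)) := by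
  by_cases hlarge : ∃ᶠ n in atTop, (q n : ℝ) ^ (2 + ε) ≤ q (n + 1)
  · obtain ⟨C, hC, h⟩ := exists_isGoodDenominator_of_rpow_le hε
    exact ⟨C, hC, hlarge.mono fun n hn => h x (q n) _ (hq n) hn⟩
  · obtain ⟨c, hc, hx⟩ := exists_diophantine_of_le_rpow hq htop (τ := 2 + ε) (by linarith)
      ((not_frequently.1 hlarge).mono fun n hn => (not_le.1 hn).le)
    obtain ⟨C, hC, h⟩ := exists_isGoodDenominator_of_diophantine hc hε hε1 hx
    exact ⟨C, hC, Frequently.of_forall fun n => h (q n) _ (hq n)⟩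

/-! ### Continued fraction denominators -/

theorem norm_nsmul_coe_le (α : ℝ) (p : ℤ) {q : ℕ} (hq : 1 ≤ q) :
    ‖q • (α : UnitAddCircle)‖ ≤ q * |α - p / q| := by
  have hq' : (0 : ℝ) < q := by exact_mod_cast hq
  have h : q • (α : UnitAddCircle) = ((q * (α - p / q) : ℝ) : UnitAddCircle) := by
    rw [← AddCircle.coe_nsmul, mul_sub, mul_div_cancel₀ _ hq'.ne', nsmul_eq_mul, AddCircle.coe_sub,
      (AddCircle.coe_eq_zero_iff (p := (1 : ℝ)) (x := (p : ℝ))).2 ⟨p, by simp⟩, sub_zero]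
  rw [h, ← abs_of_pos hq', ← abs_mul, abs_of_pos hq']
  exact norm_coe_le_abs _

theorem wellSpaced_of_abs_sub_div_le {α : ℝ} {p : ℤ} {q : ℕ} (hq : 1 ≤ q) (hpq : IsCoprime p q)
    (h : |α - p / q| ≤ 1 / (q * q)) : WellSpaced (α : UnitAddCircle) q := by
  intro n hn
  rw [Finset.mem_Icc] at hn
  have hq' : (0 : ℝ) < q := by exact_mod_cast hq
  rw [← AddCircle.coe_nsmul, nsmul_eq_mul, UnitAddCircle.norm_eq]
  set j := round ((n : ℝ) * α)
  have hne : n * p - j * q ≠ 0 := fun h0 => by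
    have hdvd : (q : ℤ) ∣ n := hpq.symm.dvd_of_dvd_mul_right ⟨j, by linarith⟩
    have := Int.le_of_dvd (by omega) hdvd
    omega
  have hgap : (1 : ℝ) / q ≤ |((n * p - j * q : ℤ) : ℝ) / q| := by
    rw [abs_div, abs_of_pos hq']
    gcongr
    exact_mod_cast Int.one_le_abs hne
  have herr : |(n : ℝ) * (α - p / q)| ≤ 1 / (2 * q) := by
    rw [abs_mul, Nat.abs_cast]
    have hnq : (n : ℝ) ≤ q / 2 := by
      rw [le_div_iff₀ two_pos]
      exact_mod_cast (by omega : n * 2 ≤ q)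
    calc (n : ℝ) * |α - p / q| ≤ q / 2 * (1 / (q * q)) := by gcongr
      _ = 1 / (2 * q) := by field_simp
  have htri := abs_sub (n * α - j) (n * (α - p / q))
  rw [show n * α - j - n * (α - p / q) = ((n * p - j * q : ℤ) : ℝ) / q by
    push_cast; field_simp; ring] at htri
  have hhalf : (1 : ℝ) / (2 * q) = (2 * q : ℝ)⁻¹ := one_div _
  have hdouble : (1 : ℝ) / q = 2 * (2 * q : ℝ)⁻¹ := by field_simp
  linarith

section Convergents

open GenContFract

theorem exists_int_contsAux (v : ℝ) (n : ℕ) :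
    ∃ a b : ℤ, (GenContFract.of v).contsAux n = ⟨(a : ℝ), (b : ℝ)⟩ := by
  induction n using Nat.strong_induction_on with
  | _ n ih =>
    rcases n with (_ | _ | n)
    · exact ⟨1, 0, by simp [contsAux]⟩
    · exact ⟨⌊v⌋, 1, by simp [contsAux]⟩
    · obtain ⟨a, b, hab⟩ := ih (n + 1) (by omega)
      obtain ⟨a', b', hab'⟩ := ih n (by omega)
      rcases hs : (GenContFract.of v).s.get? n with _ | gp
      · exact ⟨a, b, by rw [contsAux_stable_of_terminated (n + 1).le_succ hs, hab]⟩
      · obtain ⟨hnum, z, hden⟩ := of_partNum_eq_one_and_exists_int_partDen_eq hs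
        refine ⟨z * a + a', z * b + b', ?_⟩
        rw [contsAux_recurrence hs hab' hab, hnum, hden]
        push_cast
        simp only [one_mul]

/-- The numerator of the `n`-th convergent of `v`, an integer. -/
noncomputable def convNum (v : ℝ) (n : ℕ) : ℤ := ⌊(GenContFract.of v).nums n⌋

/-- The denominator of the `n`-th convergent of `v`, a natural number. -/
noncomputable def convDen (v : ℝ) (n : ℕ) : ℕ := ⌊(GenContFract.of v).dens n⌋₊

theorem cast_convNum (v : ℝ) (n : ℕ) : (convNum v n : ℝ) = (GenContFract.of v).nums n := by
  obtain ⟨a, b, h⟩ := exists_int_contsAux v (n + 1)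
  rw [convNum, num_eq_conts_a, nth_cont_eq_succ_nth_contAux, h, Int.floor_intCast]

theorem cast_convDen (v : ℝ) (n : ℕ) : (convDen v n : ℝ) = (GenContFract.of v).dens n := by
  obtain ⟨a, b, h⟩ := exists_int_contsAux v (n + 1)
  have h0 : 0 ≤ (GenContFract.of v).dens n := zero_le_of_den
  rw [den_eq_conts_b, nth_cont_eq_succ_nth_contAux, h, Int.cast_nonneg_iff] at h0
  lift b to ℕ using h0
  rw [convDen, den_eq_conts_b, nth_cont_eq_succ_nth_contAux, h, Int.cast_natCast, Nat.floor_natCast]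

variable {α : ℝ} (hα : Irrational α)
include hα

theorem not_terminatedAt_of_irrational (n : ℕ) : ¬ (GenContFract.of α).TerminatedAt n := fun h => by
  obtain ⟨p, hp⟩ := (terminates_iff_rat α).1 ⟨n, h⟩
  exact hα ⟨p, hp.symm⟩

theorem fib_succ_le_convDen (n : ℕ) : Nat.fib (n + 1) ≤ convDen α n := by
  have := succ_nth_fib_le_of_nth_den (Or.inr (not_terminatedAt_of_irrational hα (n - 1)))
  rw [← cast_convDen] at this
  exact_mod_cast this

theorem tendsto_convDen : Tendsto (convDen α) atTop atTop :=
  tendsto_atTop_mono (fib_succ_le_convDen hα)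
    ((tendsto_add_atTop_iff_nat 1).1 Nat.fib_add_two_strictMono.tendsto_atTop)

theorem isCoprime_convNum_convDen (n : ℕ) : IsCoprime (convNum α n) (convDen α n) := by
  have hdet : convNum α n * convDen α (n + 1) - convDen α n * convNum α (n + 1) =
      (-1 : ℤ) ^ (n + 1) := by
    have := SimpContFract.determinant (s := SimpContFract.of α) (n := n)
      (not_terminatedAt_of_irrational hα n)
    change (GenContFract.of α).nums n * (GenContFract.of α).dens (n + 1) -
      (GenContFract.of α).dens n * (GenContFract.of α).nums (n + 1) = _ at this
    simp only [← cast_convNum, ← cast_convDen] at this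
    exact_mod_cast this
  have hsq : (-1 : ℤ) ^ (n + 1) * (-1) ^ (n + 1) = 1 := by rw [← mul_pow]; simp
  refine ⟨(-1) ^ (n + 1) * convDen α (n + 1), -((-1) ^ (n + 1) * convNum α (n + 1)), ?_⟩
  linear_combination (-1 : ℤ) ^ (n + 1) * hdet + hsq

theorem isApproxDenominator_convDen (n : ℕ) :
    IsApproxDenominator (α : UnitAddCircle) (convDen α n) (convDen α (n + 1)) := by
  have hone : 1 ≤ convDen α n := (Nat.fib_pos.2 n.succ_pos).trans_le (fib_succ_le_convDen hα n)
  have : (1 : ℝ) ≤ convDen α n := by exact_mod_cast hone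
  have hle : (convDen α n : ℝ) ≤ convDen α (n + 1) := by
    simpa only [cast_convDen] using of_den_mono
  have happrox : |α - convNum α n / convDen α n| ≤ 1 / (convDen α n * convDen α (n + 1)) := by
    simpa only [cast_convNum, cast_convDen, conv_eq_num_div_den] using
      abs_sub_convs_le (not_terminatedAt_of_irrational hα n)
  refine ⟨hone, hle, ?_, wellSpaced_of_abs_sub_div_le hone (isCoprime_convNum_convDen hα n) ?_⟩
  · calc ‖convDen α n • (α : UnitAddCircle)‖
        ≤ convDen α n * |α - convNum α n / convDen α n| := norm_nsmul_coe_le α _ hone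
      _ ≤ convDen α n * (1 / (convDen α n * convDen α (n + 1))) := by gcongr
      _ = 1 / convDen α (n + 1) := by field_simp
  · refine happrox.trans ?_
    gcongr

end Convergents

/-! ### Fourier expansions of Birkhoff sums -/

/-- The `n`-th Fourier coefficient of a real function on the circle. -/
noncomputable def circleCoeff (f : UnitAddCircle → ℝ) (n : ℤ) : ℂ :=
  fourierCoeff (fun t => (f t : ℂ)) n

/-- `f` is the pointwise sum of its Fourier series, whose coefficients are bounded by
`C * |n| ^ (-r)`. -/
structure HasFourierDecay (f : UnitAddCircle → ℝ) (C r : ℝ) : Prop where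
  nonneg : 0 ≤ C
  hasSum : ∀ t, HasSum (fun n => circleCoeff f n * fourier n t) (f t : ℂ)
  norm_coeff_le : ∀ n ≠ 0, ‖circleCoeff f n‖ ≤ C * |(n : ℝ)| ^ (-r)

theorem circleCoeff_circleFun {f : ℝ → ℝ} (hp : Function.Periodic f 1) (hc : Continuous f)
    (n : ℤ) : circleCoeff (circleFun f hp hc) n =
      fourierCoeffOn (zero_lt_one' ℝ) (fun t => (f t : ℂ)) n := by
  rw [circleCoeff, fourierCoeffOn_eq_integral, fourierCoeff_eq_intervalIntegral _ n 0, zero_add,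
    sub_zero]
  simp only [circleFun_coe]

theorem circleCoeff_circleFun_zero {f : ℝ → ℝ} (hp : Function.Periodic f 1) (hc : Continuous f) :
    circleCoeff (circleFun f hp hc) 0 = ((∫ t in (0 : ℝ)..1, f t : ℝ) : ℂ) := by
  rw [circleCoeff_circleFun, fourierCoeffOn_eq_integral, ← intervalIntegral.integral_ofReal]
  simp

theorem IsSmoothPeriodic.mono {r s : ℝ} {f : ℝ → ℝ} (hf : IsSmoothPeriodic r f) (hs : s ≤ r) :
    IsSmoothPeriodic s f := by
  obtain ⟨C, hC⟩ := hf.decay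
  refine ⟨hf.periodic, hf.continuous, |C|, fun n hn => (hC n hn).trans ?_⟩
  have : (1 : ℝ) ≤ |(n : ℝ)| := by exact_mod_cast Int.one_le_abs hn
  gcongr
  exact le_abs_self C

theorem IsSmoothPeriodic.exists_hasFourierDecay {r : ℝ} {f : ℝ → ℝ} (hf : IsSmoothPeriodic r f)
    (hr : 1 < r) : ∃ C, HasFourierDecay (circleFun f hf.periodic hf.continuous) C r := by
  obtain ⟨C, hC⟩ := hf.decay
  set F := circleFun f hf.periodic hf.continuous
  have hbound : ∀ n ≠ 0, ‖circleCoeff F n‖ ≤ |C| * |(n : ℝ)| ^ (-r) := fun n hn => by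
    rw [circleCoeff_circleFun]
    refine (hC n hn).trans ?_
    gcongr
    exact le_abs_self C
  have hsum : Summable (circleCoeff F) :=
    .of_norm_bounded_eventually ((Real.summable_abs_int_rpow hr).mul_left |C|)
      (mem_of_superset (Set.finite_singleton (0 : ℤ)).compl_mem_cofinite hbound)
  let F' : C(UnitAddCircle, ℂ) := ⟨fun t => (F t : ℂ), Complex.continuous_ofReal.comp F.continuous⟩
  exact ⟨|C|, abs_nonneg C, has_pointwise_sum_fourier_series_of_summable (f := F') hsum, hbound⟩

namespace HasFourierDecay

variable {f : UnitAddCircle → ℝ} {C r : ℝ}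

theorem mono {s : ℝ} (h : HasFourierDecay f C r) (hs : s ≤ r) : HasFourierDecay f C s := by
  refine ⟨h.nonneg, h.hasSum, fun n hn => (h.norm_coeff_le n hn).trans ?_⟩
  have : (1 : ℝ) ≤ |(n : ℝ)| := by exact_mod_cast Int.one_le_abs hn
  have := h.nonneg
  gcongr

theorem norm_coeff_le_of_mean_zero (h : HasFourierDecay f C r) (h0 : circleCoeff f 0 = 0) (n : ℤ) :
    ‖circleCoeff f n‖ ≤ C * |(n : ℝ)| ^ (-r) := by
  rcases eq_or_ne n 0 with rfl | hn
  · rw [h0, norm_zero]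
    exact mul_nonneg h.nonneg (by positivity)
  · exact h.norm_coeff_le n hn

end HasFourierDecay

/-- The double Birkhoff sum `∑ f (T^i t) * g (T^j t)` over `i < j < n`. -/
def doubleBirkhoffSum {X R : Type*} [NonUnitalNonAssocSemiring R] (T : X → X) (f g : X → R) (n : ℕ)
    (t : X) : R :=
  ∑ j ∈ Finset.range n, birkhoffSum T f j t * g (T^[j] t)

theorem fourier_apply_iterate_add (x t : UnitAddCircle) (n : ℤ) (j : ℕ) :
    (fourier n ((· + x)^[j] t) : ℂ) = fourier n t * fourier n x ^ j := by
  rw [add_right_iterate_apply, fourier_apply, smul_add, smul_comm, AddCircle.toCircle_add,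
    AddCircle.toCircle_nsmul, Circle.coe_mul, Circle.coe_pow, fourier_apply, fourier_apply]

/-- The terms `|n| ^ (-r) * ‖expSum x q n‖` that bound the Fourier series of a Birkhoff sum. -/
noncomputable def expTerm (x : UnitAddCircle) (q : ℕ) (r : ℝ) (n : ℤ) : ℝ :=
  |(n : ℝ)| ^ (-r) * ‖expSum x q n‖

theorem expTerm_nonneg (x : UnitAddCircle) (q : ℕ) (r : ℝ) (n : ℤ) : 0 ≤ expTerm x q r n := by
  unfold expTerm
  positivity

theorem summable_expTerm (x : UnitAddCircle) (q : ℕ) {r : ℝ} (hr : 1 < r) :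
    Summable (expTerm x q r) :=
  .of_nonneg_of_le (expTerm_nonneg x q r)
    (fun n => mul_le_mul_of_nonneg_left (norm_geom_sum_le (norm_fourier_apply n x) q)
      (by positivity))
    ((Real.summable_abs_int_rpow hr).mul_right _)

theorem HasFourierDecay.hasSum_birkhoffSum {f : UnitAddCircle → ℝ} {C r : ℝ}
    (h : HasFourierDecay f C r) (x : UnitAddCircle) (q : ℕ) (t : UnitAddCircle) :
    HasSum (fun n => circleCoeff f n * fourier n t * expSum x q n)
      ((birkhoffSum (· + x) f q t : ℝ) : ℂ) := by
  have hsum := hasSum_sum (s := Finset.range q) fun j _ => h.hasSum ((· + x)^[j] t)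
  simp only [fourier_apply_iterate_add, ← mul_assoc, ← Finset.mul_sum] at hsum
  simpa only [birkhoffSum, expSum, Complex.ofReal_sum] using hsum

theorem HasFourierDecay.abs_birkhoffSum_sub_le {f : UnitAddCircle → ℝ} {C r : ℝ}
    (h : HasFourierDecay f C r) (hr : 1 < r) (x : UnitAddCircle) (q : ℕ) (t : UnitAddCircle) :
    |birkhoffSum (· + x) f q t - q * (circleCoeff f 0).re| ≤ C * ∑' n, expTerm x q r n := by
  have hsum := (h.hasSum_birkhoffSum x q t).sub (hasSum_ite_eq (0 : ℤ) (q * circleCoeff f 0))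
  have hterm : ∀ n : ℤ, ‖circleCoeff f n * fourier n t * expSum x q n -
      (if n = 0 then q * circleCoeff f 0 else 0)‖ ≤ C * expTerm x q r n := fun n => by
    rcases eq_or_ne n 0 with rfl | hn
    · have hzero : expSum x q 0 = q := by simp [expSum]
      rw [if_pos rfl, hzero, fourier_zero, mul_one, mul_comm, sub_self, norm_zero]
      exact mul_nonneg h.nonneg (expTerm_nonneg x q r 0)
    · rw [if_neg hn, sub_zero, norm_mul, norm_mul, norm_fourier_apply, mul_one, expTerm,
        ← mul_assoc]
      gcongr
      exact h.norm_coeff_le n hn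
  have hnorm := tsum_of_norm_bounded ((summable_expTerm x q hr).hasSum.mul_left C) hterm
  rw [hsum.tsum_eq] at hnorm
  simpa using (Complex.abs_re_le_norm _).trans hnorm

theorem hasSum_mul_complex {ι κ : Type*} {a : ι → ℂ} {b : κ → ℂ} {A B : ℂ} (ha : HasSum a A)
    (hb : HasSum b B) : HasSum (fun p : ι × κ => a p.1 * b p.2) (A * B) :=
  ha.mul hb (summable_mul_of_summable_norm ha.summable.norm hb.summable.norm)

theorem HasFourierDecay.hasSum_doubleBirkhoffSum {f g : UnitAddCircle → ℝ} {C D r s : ℝ}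
    (hf : HasFourierDecay f C r) (hg : HasFourierDecay g D s) (x : UnitAddCircle) (q : ℕ)
    (t : UnitAddCircle) :
    HasSum (fun p : ℤ × ℤ => circleCoeff f p.1 * circleCoeff g p.2 * fourier (p.1 + p.2) t *
      doubleGeom (fourier p.1 x) (fourier p.2 x) q)
      ((doubleBirkhoffSum (· + x) f g q t : ℝ) : ℂ) := by
  have hprod (s s' : UnitAddCircle) := hasSum_mul_complex (hf.hasSum s) (hg.hasSum s')
  have hsum := hasSum_sum (s := Finset.range q) fun j _ =>
    hasSum_sum (s := Finset.range j) fun i _ =>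
      hprod ((· + x)^[i] t) ((· + x)^[j] t)
  simp only [doubleBirkhoffSum, birkhoffSum, Complex.ofReal_sum, Complex.ofReal_mul,
    Finset.sum_mul]
  refine hsum.congr_fun fun p => ?_
  simp only [doubleGeom, Finset.mul_sum, fourier_apply_iterate_add, fourier_add]
  exact Finset.sum_congr rfl fun j _ => Finset.sum_congr rfl fun i _ => by ring

/-! ### Bounds for Birkhoff sums -/

theorem IsApproxDenominator.norm_zsmul_pos {x : UnitAddCircle} {q : ℕ} {Q : ℝ}
    (h : IsApproxDenominator x q Q) {n : ℤ} (hn : n ≠ 0) (hnq : 2 * |n| ≤ q) : 0 < ‖n • x‖ := by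
  have := h.one_le_cast
  exact (by positivity : 0 < (2 * (q : ℝ))⁻¹).trans_le (h.wellSpaced.le_norm_zsmul hn (by omega))

theorem expTerm_le {x : UnitAddCircle} {q : ℕ} {Q r : ℝ} (h : IsApproxDenominator x q Q)
    (hr : r ≠ 0) (n : ℤ) :
    expTerm x q r n ≤ 2 / Q * headTerm x q (r - 1) n + tailTerm x q r n := by
  have : 0 ≤ Q := (Nat.cast_nonneg q).trans h.le
  rcases eq_or_ne n 0 with rfl | hn
  · simp [expTerm, headTerm, tailTerm, hr]
  have hn0 : (0 : ℝ) < |(n : ℝ)| := abs_pos.2 (by exact_mod_cast hn)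
  rcases lt_or_ge (q : ℤ) (2 * |n|) with hlt | hge
  · rw [headTerm, if_neg hlt.not_ge, tailTerm, if_pos hlt, mul_zero, zero_add, expTerm]
    gcongr
    exact norm_expSum_le_majorant x q n
  · rw [headTerm, if_pos hge, tailTerm, if_neg hge.not_gt, add_zero]
    calc |(n : ℝ)| ^ (-r) * ‖expSum x q n‖
        ≤ |(n : ℝ)| ^ (-r) * (2 * |(n : ℝ)| / (Q * ‖n • x‖)) := by
          gcongr
          exact norm_expSum_le_of_norm_nsmul_le h.norm_nsmul_le
            (norm_pos_iff.1 (h.norm_zsmul_pos hn hge))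
      _ = 2 / Q * (|(n : ℝ)| ^ (-r) * |(n : ℝ)| / ‖n • x‖) := by ring
      _ = 2 / Q * (|(n : ℝ)| ^ (-(r - 1)) / ‖n • x‖) := by
          rw [show -(r - 1) = -r + 1 by ring, Real.rpow_add hn0, Real.rpow_one]

theorem exists_tsum_expTerm_le {r l : ℝ} (hr : 1 < r) (hl : 0 < l) :
    ∃ C : ℝ, 0 ≤ C ∧ ∀ (x : UnitAddCircle) (q : ℕ) (Q : ℝ), IsApproxDenominator x q Q →
      ∑' n, expTerm x q r n ≤ 4 * (headSum x q (r - 1) / Q) + C * (q : ℝ) ^ (1 - r + l) := by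
  obtain ⟨C, hC, htail⟩ := exists_tsum_tailTerm_le hr hl
  refine ⟨C, hC, fun x q Q h => ?_⟩
  have hQ : 0 ≤ Q := (Nat.cast_nonneg q).trans h.le
  have hhead := (summable_headTerm x q (r - 1)).mul_left (2 / Q)
  calc ∑' n, expTerm x q r n
      ≤ ∑' n, (2 / Q * headTerm x q (r - 1) n + tailTerm x q r n) :=
        (summable_expTerm x q hr).tsum_le_tsum (expTerm_le h (by linarith))
          (hhead.add (summable_tailTerm x q hr))
    _ = 2 / Q * ∑' n, headTerm x q (r - 1) n + ∑' n, tailTerm x q r n := by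
        rw [hhead.tsum_add (summable_tailTerm x q hr), tsum_mul_left]
    _ ≤ 2 / Q * (2 * headSum x q (r - 1)) + C * (q : ℝ) ^ (1 - r + l) := by
        gcongr
        · exact tsum_headTerm_le x q _
        · exact htail x q h.one_le h.wellSpaced
    _ = _ := by ring

theorem abs_rpow_neg_le_of_abs_le_two_mul {r : ℝ} (hr : 0 ≤ r) {k n : ℤ} (hn : n ≠ 0)
    (h : |n| ≤ 2 * |k|) : |(k : ℝ)| ^ (-r) ≤ 2 ^ r * |(n : ℝ)| ^ (-r) := by
  have hn0 : (0 : ℝ) < |(n : ℝ)| := abs_pos.2 (by exact_mod_cast hn)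
  have hk : |(n : ℝ)| / 2 ≤ |(k : ℝ)| := by
    rw [div_le_iff₀' two_pos]
    exact_mod_cast h
  calc |(k : ℝ)| ^ (-r) ≤ (|(n : ℝ)| / 2) ^ (-r) :=
        Real.rpow_le_rpow_of_nonpos (by positivity) hk (by linarith)
    _ = 2 ^ r * |(n : ℝ)| ^ (-r) := by
        rw [Real.div_rpow hn0.le two_pos.le, Real.rpow_neg two_pos.le]
        field_simp

/-- A bound for the terms with `|k| ≤ |l|` of the Fourier series of a double Birkhoff sum. -/
noncomputable def pairTerm (x : UnitAddCircle) (q : ℕ) (r : ℝ) (p : ℤ × ℤ) : ℝ :=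
  headTerm x q r p.1 * expTerm x q r p.2 + 2 ^ r * (headTerm x q r p.1 * expTerm x q r (p.1 + p.2))
    + q * (tailTerm x q r p.1 * |(p.2 : ℝ)| ^ (-r))

theorem pairTerm_nonneg (x : UnitAddCircle) (q : ℕ) (r : ℝ) (p : ℤ × ℤ) :
    0 ≤ pairTerm x q r p := by
  have := headTerm_nonneg x q r p.1
  have := expTerm_nonneg x q r p.2
  have := expTerm_nonneg x q r (p.1 + p.2)
  have := tailTerm_nonneg x q r p.1
  unfold pairTerm
  positivity

theorem norm_doubleGeom_le_pairTerm_of_abs_le {x : UnitAddCircle} {q : ℕ} {Q r : ℝ}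
    (h : IsApproxDenominator x q Q) (hr : 0 < r) {k l : ℤ} (hkl : k + l ≠ 0) (hle : |k| ≤ |l|) :
    |(k : ℝ)| ^ (-r) * |(l : ℝ)| ^ (-r) * ‖doubleGeom (fourier k x) (fourier l x) q‖ ≤
      pairTerm x q r (k, l) := by
  rcases eq_or_ne k 0 with rfl | hk
  · simpa [hr.ne'] using pairTerm_nonneg x q r (0, l)
  rcases lt_or_ge (q : ℤ) (2 * |k|) with hlt | hge
  · simp only [pairTerm, headTerm, tailTerm, if_pos hlt, if_neg hlt.not_ge, zero_mul, mul_zero,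
      zero_add]
    calc _ ≤ |(k : ℝ)| ^ (-r) * |(l : ℝ)| ^ (-r) * (q * majorant x q k) := by
          gcongr
          exact norm_doubleGeom_le_majorant x q k l
      _ = _ := by ring
  have hgeom : ‖doubleGeom (fourier k x) (fourier l x) q‖ ≤
      (‖expSum x q (k + l)‖ + ‖expSum x q l‖) / ‖k • x‖ := by
    rw [le_div_iff₀' (h.norm_zsmul_pos hk hge)]
    refine le_trans ?_ (norm_zsmul_mul_norm_doubleGeom_le x q k l)
    exact le_mul_of_one_le_left (by positivity) (by norm_num)
  have hweight : |(l : ℝ)| ^ (-r) ≤ 2 ^ r * |((k + l : ℤ) : ℝ)| ^ (-r) :=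
    abs_rpow_neg_le_of_abs_le_two_mul hr.le hkl (by have := abs_add_le k l; omega)
  simp only [pairTerm, headTerm, tailTerm, expTerm, if_pos hge, if_neg hge.not_gt, zero_mul,
    mul_zero, add_zero]
  calc |(k : ℝ)| ^ (-r) * |(l : ℝ)| ^ (-r) * ‖doubleGeom (fourier k x) (fourier l x) q‖
      ≤ |(k : ℝ)| ^ (-r) * |(l : ℝ)| ^ (-r) *
          ((‖expSum x q (k + l)‖ + ‖expSum x q l‖) / ‖k • x‖) := by gcongr
    _ = |(k : ℝ)| ^ (-r) / ‖k • x‖ * (|(l : ℝ)| ^ (-r) * ‖expSum x q l‖) +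
          |(k : ℝ)| ^ (-r) / ‖k • x‖ * (|(l : ℝ)| ^ (-r) * ‖expSum x q (k + l)‖) := by ring
    _ ≤ |(k : ℝ)| ^ (-r) / ‖k • x‖ * (|(l : ℝ)| ^ (-r) * ‖expSum x q l‖) +
          |(k : ℝ)| ^ (-r) / ‖k • x‖ *
            (2 ^ r * |((k + l : ℤ) : ℝ)| ^ (-r) * ‖expSum x q (k + l)‖) := by gcongr
    _ = _ := by ring

theorem norm_doubleGeom_le_pairTerm_add {x : UnitAddCircle} {q : ℕ} {Q r : ℝ}
    (h : IsApproxDenominator x q Q) (hr : 0 < r) {p : ℤ × ℤ} (hp : p.1 + p.2 ≠ 0) :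
    |(p.1 : ℝ)| ^ (-r) * |(p.2 : ℝ)| ^ (-r) * ‖doubleGeom (fourier p.1 x) (fourier p.2 x) q‖ ≤
      pairTerm x q r p + pairTerm x q r p.swap := by
  rcases le_total |p.1| |p.2| with hle | hle
  · exact (norm_doubleGeom_le_pairTerm_of_abs_le h hr hp hle).trans
      (le_add_of_nonneg_right (pairTerm_nonneg ..))
  · rw [norm_doubleGeom_comm (norm_fourier_apply _ x) (norm_fourier_apply _ x),
      mul_comm (|(p.1 : ℝ)| ^ (-r))]
    rw [add_comm] at hp
    exact (norm_doubleGeom_le_pairTerm_of_abs_le h hr hp hle).trans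
      (le_add_of_nonneg_left (pairTerm_nonneg ..))

theorem hasSum_mul_add {a b : ℤ → ℝ} (ha : Summable a) (hb : Summable b) (ha0 : ∀ n, 0 ≤ a n)
    (hb0 : ∀ n, 0 ≤ b n) :
    HasSum (fun p : ℤ × ℤ => a p.1 * b (p.1 + p.2)) ((∑' n, a n) * ∑' n, b n) :=
  ((Equiv.refl ℤ).prodShear Equiv.addLeft).hasSum_iff.2
    (ha.hasSum.mul hb.hasSum (ha.mul_of_nonneg hb ha0 hb0))

theorem hasSum_pairTerm (x : UnitAddCircle) (q : ℕ) {r : ℝ} (hr : 1 < r) :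
    HasSum (pairTerm x q r) ((1 + 2 ^ r) * ((∑' n, headTerm x q r n) * ∑' n, expTerm x q r n) +
      q * ((∑' n, tailTerm x q r n) * ∑' n : ℤ, |(n : ℝ)| ^ (-r))) := by
  have hH := summable_headTerm x q r
  have hE := summable_expTerm x q hr
  have hT := summable_tailTerm x q hr
  have hW := Real.summable_abs_int_rpow hr
  have hH0 := headTerm_nonneg x q r
  have hE0 := expTerm_nonneg x q r
  have hHE := hH.hasSum.mul hE.hasSum (hH.mul_of_nonneg hE hH0 hE0)
  have hTW := hT.hasSum.mul hW.hasSum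
    (hT.mul_of_nonneg hW (tailTerm_nonneg x q r) fun n => by positivity)
  rw [add_mul, one_mul]
  exact (hHE.add ((hasSum_mul_add hH hE hH0 hE0).mul_left _)).add (hTW.mul_left _)

theorem HasFourierDecay.exists_abs_doubleBirkhoffSum_sub_le {f g : UnitAddCircle → ℝ} {C D r : ℝ}
    (hf : HasFourierDecay f C r) (hg : HasFourierDecay g D r) (hf0 : circleCoeff f 0 = 0)
    (hg0 : circleCoeff g 0 = 0) (hr : 1 < r) {x : UnitAddCircle} {q : ℕ} {Q : ℝ}
    (h : IsApproxDenominator x q Q) :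
    ∃ β : ℝ, ∀ t,
      |doubleBirkhoffSum (· + x) f g q t - β| ≤ C * D * (2 * ∑' p, pairTerm x q r p) := by
  have hCD := mul_nonneg hf.nonneg hg.nonneg
  have hpair := (hasSum_pairTerm x q hr).summable.hasSum
  have hmajor : HasSum (fun p : ℤ × ℤ => C * D * (pairTerm x q r p + pairTerm x q r p.swap))
      (C * D * (2 * ∑' p, pairTerm x q r p)) := by
    rw [two_mul]
    exact (hpair.add ((Equiv.prodComm ℤ ℤ).hasSum_iff.2 hpair)).mul_left _
  set z : UnitAddCircle → ℤ × ℤ → ℂ := fun t p => circleCoeff f p.1 * circleCoeff g p.2 *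
    fourier (p.1 + p.2) t * doubleGeom (fourier p.1 x) (fourier p.2 x) q with hz
  have hbound : ∀ t p, ‖if p.1 + p.2 = 0 then 0 else z t p‖ ≤
      C * D * (pairTerm x q r p + pairTerm x q r p.swap) := by
    intro t p
    split_ifs with hp
    · rw [norm_zero]
      exact mul_nonneg hCD (add_nonneg (pairTerm_nonneg ..) (pairTerm_nonneg ..))
    rw [hz, norm_mul, norm_mul, norm_mul, norm_fourier_apply, mul_one]
    calc _ ≤ C * |(p.1 : ℝ)| ^ (-r) * (D * |(p.2 : ℝ)| ^ (-r)) *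
          ‖doubleGeom (fourier p.1 x) (fourier p.2 x) q‖ := by
          gcongr
          · exact mul_nonneg hf.nonneg (by positivity)
          · exact hf.norm_coeff_le_of_mean_zero hf0 p.1
          · exact hg.norm_coeff_le_of_mean_zero hg0 p.2
      _ = C * D * (|(p.1 : ℝ)| ^ (-r) * |(p.2 : ℝ)| ^ (-r) *
          ‖doubleGeom (fourier p.1 x) (fourier p.2 x) q‖) := by ring
      _ ≤ _ := by
          gcongr
          exact norm_doubleGeom_le_pairTerm_add h (by linarith) hp
  -- The terms with `k + l = 0` do not depend on `t`; they add up to the constant `β`.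
  have hdiag : ∀ t p, (z t p - if p.1 + p.2 = 0 then 0 else z t p) =
      if p.1 + p.2 = 0 then z 0 p else 0 := fun t p => by
    split_ifs with hp <;> simp only [hz, hp, fourier_zero, sub_zero, sub_self]
  refine ⟨(∑' p : ℤ × ℤ, if p.1 + p.2 = 0 then z 0 p else 0).re, fun t => ?_⟩
  have hoff := (Summable.of_norm_bounded hmajor.summable (hbound t)).hasSum
  have hdiff := (hf.hasSum_doubleBirkhoffSum hg x q t).sub hoff
  rw [funext (hdiag t)] at hdiff
  rw [hdiff.tsum_eq, Complex.sub_re, Complex.ofReal_re, sub_sub_cancel]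
  exact (Complex.abs_re_le_norm _).trans (tsum_of_norm_bounded hmajor (hbound t))

theorem IsApproxDenominator.rpow_le_rpow {x : UnitAddCircle} {q : ℕ} {Q : ℝ}
    (h : IsApproxDenominator x q Q) {a b : ℝ} (hab : a ≤ b) : (q : ℝ) ^ a ≤ (q : ℝ) ^ b :=
  Real.rpow_le_rpow_of_exponent_le h.one_le_cast hab

theorem exists_tsum_expTerm_le_of_isGoodDenominator {ε : ℝ} (hε : 0 < ε) (C₀ : ℝ) :
    ∃ C : ℝ, ∀ (x : UnitAddCircle) (q : ℕ) (Q : ℝ), IsGoodDenominator x ε C₀ q Q →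
      ∑' n, expTerm x q (1 + ε) n ≤ C * (q : ℝ) ^ (-(ε / 5)) := by
  obtain ⟨C, hC, hexp⟩ := exists_tsum_expTerm_le (r := 1 + ε) (l := ε / 2) (by linarith)
    (by linarith)
  refine ⟨4 * C₀ + C, fun x q Q h => (hexp x q Q h.toIsApproxDenominator).trans ?_⟩
  have hQ : 0 < Q := (by positivity : (0 : ℝ) < 1).trans_le (h.one_le_cast.trans h.le)
  have hhead : headSum x q (1 + ε - 1) / Q ≤ C₀ * (q : ℝ) ^ (-(ε / 5)) := by
    rw [add_sub_cancel_left, div_le_iff₀ hQ]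
    exact h.headSum_le
  rw [add_mul, mul_assoc]
  gcongr 4 * ?_ + C * ?_
  exact h.rpow_le_rpow (by linarith)

theorem exists_tsum_headTerm_mul_tsum_expTerm_le {ε : ℝ} (hε : 0 < ε) (C₀ : ℝ) :
    ∃ C : ℝ, ∀ (x : UnitAddCircle) (q : ℕ) (Q : ℝ), IsGoodDenominator x ε C₀ q Q →
      (∑' n, headTerm x q (2 + 2 * ε) n) * ∑' n, expTerm x q (2 + 2 * ε) n ≤
        C * (q : ℝ) ^ (-(ε / 5)) := by
  obtain ⟨C, hC, hexp⟩ := exists_tsum_expTerm_le (r := 2 + 2 * ε) (l := ε / 4) (by linarith)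
    (by linarith)
  obtain ⟨K, hK, hhead⟩ := exists_headSum_le (l := ε / 4) (by linarith)
  refine ⟨8 * C₀ + 2 * (K * C), fun x q Q h => ?_⟩
  have hQ : 0 < Q := (by positivity : (0 : ℝ) < 1).trans_le (h.one_le_cast.trans h.le)
  have hq := h.one_le_cast
  have hH := headSum_nonneg x q (2 + 2 * ε)
  have hmain : headSum x q (2 + 2 * ε) * (headSum x q (1 + 2 * ε) / Q) ≤
      C₀ * (q : ℝ) ^ (-(ε / 5)) := by
    rw [← mul_div_assoc, div_le_iff₀ hQ]
    exact h.headSum_mul_headSum_le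
  have hrest : headSum x q (2 + 2 * ε) * (C * (q : ℝ) ^ (1 - (2 + 2 * ε) + ε / 4)) ≤
      K * C * (q : ℝ) ^ (-(ε / 5)) :=
    calc _ ≤ K * (q : ℝ) ^ (1 + ε / 4) * (C * (q : ℝ) ^ (1 - (2 + 2 * ε) + ε / 4)) := by
          gcongr
          exact hhead x q _ h.one_le h.wellSpaced (by linarith)
      _ = K * C * (q : ℝ) ^ (1 + ε / 4 + (1 - (2 + 2 * ε) + ε / 4)) := by
          rw [Real.rpow_add (by positivity) (1 + ε / 4), mul_mul_mul_comm]
      _ ≤ _ := by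
          gcongr K * C * ?_
          exact h.rpow_le_rpow (by linarith)
  calc _ ≤ 2 * headSum x q (2 + 2 * ε) * (4 * (headSum x q (2 + 2 * ε - 1) / Q) +
          C * (q : ℝ) ^ (1 - (2 + 2 * ε) + ε / 4)) := by
        gcongr
        · exact tsum_nonneg (expTerm_nonneg x q _)
        · exact tsum_headTerm_le x q _
        · exact hexp x q Q h.toIsApproxDenominator
    _ = 8 * (headSum x q (2 + 2 * ε) * (headSum x q (1 + 2 * ε) / Q)) +
          2 * (headSum x q (2 + 2 * ε) * (C * (q : ℝ) ^ (1 - (2 + 2 * ε) + ε / 4))) := by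
        rw [show 2 + 2 * ε - 1 = 1 + 2 * ε by ring]
        ring
    _ ≤ 8 * (C₀ * (q : ℝ) ^ (-(ε / 5))) + 2 * (K * C * (q : ℝ) ^ (-(ε / 5))) := by gcongr
    _ = _ := by ring

theorem exists_tsum_pairTerm_le {ε : ℝ} (hε : 0 < ε) (C₀ : ℝ) :
    ∃ C : ℝ, ∀ (x : UnitAddCircle) (q : ℕ) (Q : ℝ), IsGoodDenominator x ε C₀ q Q →
      ∑' p, pairTerm x q (2 + 2 * ε) p ≤ C * (q : ℝ) ^ (-(ε / 5)) := by
  obtain ⟨C₁, hHE⟩ := exists_tsum_headTerm_mul_tsum_expTerm_le hε C₀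
  obtain ⟨C₂, hC₂, htail⟩ := exists_tsum_tailTerm_le (s := 2 + 2 * ε) (l := ε / 4) (by linarith)
    (by linarith)
  set W : ℝ := ∑' n : ℤ, |(n : ℝ)| ^ (-(2 + 2 * ε))
  have : 0 ≤ W := tsum_nonneg fun n => by positivity
  refine ⟨(1 + 2 ^ (2 + 2 * ε)) * C₁ + C₂ * W, fun x q Q h => ?_⟩
  have hq := h.one_le_cast
  have hTW : q * ((∑' n, tailTerm x q (2 + 2 * ε) n) * W) ≤ C₂ * W * (q : ℝ) ^ (-(ε / 5)) :=
    calc _ ≤ (q : ℝ) ^ (1 : ℝ) * (C₂ * (q : ℝ) ^ (1 - (2 + 2 * ε) + ε / 4) * W) := by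
          rw [Real.rpow_one]
          gcongr
          exact htail x q h.one_le h.wellSpaced
      _ = C₂ * W * (q : ℝ) ^ (1 + (1 - (2 + 2 * ε) + ε / 4)) := by
          rw [Real.rpow_add (by positivity) 1]
          simp only [mul_assoc, mul_left_comm, mul_comm]
      _ ≤ _ := by
          gcongr C₂ * W * ?_
          exact h.rpow_le_rpow (by linarith)
  rw [(hasSum_pairTerm x q (by linarith)).tsum_eq]
  calc _ ≤ (1 + 2 ^ (2 + 2 * ε)) * (C₁ * (q : ℝ) ^ (-(ε / 5))) +
          C₂ * W * (q : ℝ) ^ (-(ε / 5)) := by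
        exact add_le_add (mul_le_mul_of_nonneg_left (hHE x q Q h) (by positivity)) hTW
    _ = _ := by ring

theorem exists_birkhoffSum_bounds {φ η ψ : UnitAddCircle → ℝ} {Cφ Cη Cψ ε : ℝ} (hε : 0 < ε)
    (hφ : HasFourierDecay φ Cφ (2 + 2 * ε)) (hη : HasFourierDecay η Cη (2 + 2 * ε))
    (hψ : HasFourierDecay ψ Cψ (1 + ε)) (hφ0 : circleCoeff φ 0 = 0) (hη0 : circleCoeff η 0 = 0)
    (C₀ : ℝ) :
    ∃ C : ℝ, ∀ (x : UnitAddCircle) (q : ℕ) (Q : ℝ), IsGoodDenominator x ε C₀ q Q → ∃ β : ℝ, ∀ t,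
      |birkhoffSum (· + x) φ q t| ≤ C * (q : ℝ) ^ (-(ε / 5)) ∧
      |birkhoffSum (· + x) η q t| ≤ C * (q : ℝ) ^ (-(ε / 5)) ∧
      |birkhoffSum (· + x) ψ q t + doubleBirkhoffSum (· + x) φ η q t - β| ≤
        C * (q : ℝ) ^ (-(ε / 5)) := by
  obtain ⟨E, hE⟩ := exists_tsum_expTerm_le_of_isGoodDenominator hε C₀
  obtain ⟨P, hP⟩ := exists_tsum_pairTerm_le hε C₀
  set B := Cψ * E + Cφ * Cη * (2 * P)
  refine ⟨max (Cφ * E) (max (Cη * E) B), fun x q Q h => ?_⟩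
  set y : ℝ := (q : ℝ) ^ (-(ε / 5))
  have hbirkhoff : ∀ {f : UnitAddCircle → ℝ} {C : ℝ}, HasFourierDecay f C (1 + ε) → ∀ t,
      |birkhoffSum (· + x) f q t - q * (circleCoeff f 0).re| ≤ C * E * y := fun {f C} hf t => by
    have hsum := mul_le_mul_of_nonneg_left (hE x q Q h) hf.nonneg
    rw [← mul_assoc] at hsum
    exact (hf.abs_birkhoffSum_sub_le (by linarith) x q t).trans hsum
  obtain ⟨β, hβ⟩ := hφ.exists_abs_doubleBirkhoffSum_sub_le hη hφ0 hη0 (by linarith)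
    h.toIsApproxDenominator
  have hdouble : ∀ t, |doubleBirkhoffSum (· + x) φ η q t - β| ≤ Cφ * Cη * (2 * P) * y := fun t => by
    have hCC := mul_nonneg hφ.nonneg hη.nonneg
    have hsum := mul_le_mul_of_nonneg_left (hP x q Q h) (mul_nonneg hCC two_pos.le)
    linarith [hβ t]
  refine ⟨q * (circleCoeff ψ 0).re + β, fun t => ⟨?_, ?_, ?_⟩⟩
  · have := hbirkhoff (hφ.mono (by linarith)) t
    rw [hφ0, Complex.zero_re, mul_zero, sub_zero] at this
    exact this.trans (by gcongr; exact le_max_left _ _)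
  · have := hbirkhoff (hη.mono (by linarith)) t
    rw [hη0, Complex.zero_re, mul_zero, sub_zero] at this
    exact this.trans (by gcongr; exact le_max_of_le_right (le_max_left _ _))
  · rw [add_sub_add_comm]
    calc _ ≤ Cψ * E * y + Cφ * Cη * (2 * P) * y :=
          (abs_add_le _ _).trans (add_le_add (hbirkhoff hψ t) (hdouble t))
      _ = B * y := by ring
      _ ≤ _ := by gcongr; exact le_max_of_le_right (le_max_right _ _)

/-! ### Lipschitz functions on the phase space -/

namespace Heis

/-- The homogeneous gauge on the Heisenberg group: it is homogeneous of degree `1` under the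
dilations `(a, c, b) ↦ (s a, s² c, s b)`. It is subadditive, but symmetric only up to a factor. -/
noncomputable def gauge (g : Heis) : ℝ := max (max |g.a| |g.b|) √|g.c|

theorem gauge_nonneg (g : Heis) : 0 ≤ g.gauge := le_max_of_le_right (Real.sqrt_nonneg _)

theorem gauge_le {g : Heis} {τ : ℝ} (hτ : 0 ≤ τ) (ha : |g.a| ≤ τ) (hb : |g.b| ≤ τ)
    (hc : |g.c| ≤ τ ^ 2) : g.gauge ≤ τ :=
  max_le (max_le ha hb) ((Real.sqrt_le_left hτ).2 hc)

theorem abs_a_le_gauge (g : Heis) : |g.a| ≤ g.gauge := (le_max_left _ _).trans (le_max_left _ _)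

theorem abs_b_le_gauge (g : Heis) : |g.b| ≤ g.gauge := (le_max_right _ _).trans (le_max_left _ _)

theorem abs_c_le_gauge_sq (g : Heis) : |g.c| ≤ g.gauge ^ 2 :=
  (Real.sqrt_le_left g.gauge_nonneg).1 (le_max_right _ _)

theorem abs_a_mul_b_le (g h : Heis) : |g.a * h.b| ≤ g.gauge * h.gauge := by
  rw [abs_mul]
  exact mul_le_mul g.abs_a_le_gauge h.abs_b_le_gauge (abs_nonneg _) g.gauge_nonneg

theorem gauge_mul_le (g h : Heis) : (g * h).gauge ≤ g.gauge + h.gauge := by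
  have hg := g.gauge_nonneg
  have hh := h.gauge_nonneg
  refine gauge_le (by positivity) ?_ ?_ ?_
  · exact (abs_add_le _ _).trans (add_le_add g.abs_a_le_gauge h.abs_a_le_gauge)
  · exact (abs_add_le _ _).trans (add_le_add g.abs_b_le_gauge h.abs_b_le_gauge)
  · calc |g.c + h.c + g.a * h.b| ≤ |g.c| + |h.c| + |g.a * h.b| := abs_add_three _ _ _
      _ ≤ g.gauge ^ 2 + h.gauge ^ 2 + g.gauge * h.gauge :=
          add_le_add_three g.abs_c_le_gauge_sq h.abs_c_le_gauge_sq (abs_a_mul_b_le g h)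
      _ ≤ (g.gauge + h.gauge) ^ 2 := by nlinarith

theorem gauge_inv_le (g : Heis) : g⁻¹.gauge ≤ 2 * g.gauge := by
  have hg := g.gauge_nonneg
  refine gauge_le (by positivity) ?_ ?_ ?_
  · rw [inv_a, abs_neg]
    linarith [g.abs_a_le_gauge]
  · rw [inv_b, abs_neg]
    linarith [g.abs_b_le_gauge]
  · calc |g.a * g.b - g.c| ≤ |g.a * g.b| + |g.c| := abs_sub _ _
      _ ≤ g.gauge * g.gauge + g.gauge ^ 2 := add_le_add (abs_a_mul_b_le g g) g.abs_c_le_gauge_sq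
      _ ≤ (2 * g.gauge) ^ 2 := by nlinarith

@[simp] theorem gauge_one : gauge 1 = 0 := by simp [gauge]

theorem continuous_gauge : Continuous gauge :=
  (continuous_a.abs.max continuous_b.abs).max continuous_c.abs.sqrt

theorem tendsto_one_of_tendsto_gauge {ι : Type*} {l : Filter ι} {u : ι → Heis}
    (hu : Tendsto (fun n => (u n).gauge) l (𝓝 0)) : Tendsto u l (𝓝 1) := by
  have ha : Tendsto (fun n => (u n).a) l (𝓝 0) :=
    squeeze_zero_norm (fun n => (u n).abs_a_le_gauge) hu
  have hb : Tendsto (fun n => (u n).b) l (𝓝 0) :=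
    squeeze_zero_norm (fun n => (u n).abs_b_le_gauge) hu
  have hc : Tendsto (fun n => (u n).c) l (𝓝 0) :=
    squeeze_zero_norm (fun n => (u n).abs_c_le_gauge_sq) (by simpa using hu.pow 2)
  have hm : Continuous (fun p : ℝ × ℝ × ℝ => (⟨p.1, p.2.1, p.2.2⟩ : Heis)) :=
    continuous_mk (by fun_prop) (by fun_prop) (by fun_prop)
  exact (hm.tendsto (0, 0, 0)).comp (ha.prodMk_nhds (hc.prodMk_nhds hb))

theorem isClosed_lattice : IsClosed (lattice : Set Heis) := by
  have h : (lattice : Set Heis) = {g | g.a ∈ Set.range ((↑) : ℤ → ℝ)} ∩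
      {g | g.c ∈ Set.range ((↑) : ℤ → ℝ)} ∩ {g | g.b ∈ Set.range ((↑) : ℤ → ℝ)} := by
    ext g
    constructor
    · rintro ⟨k, m, l, rfl⟩
      exact ⟨⟨⟨k, rfl⟩, ⟨m, rfl⟩⟩, ⟨l, rfl⟩⟩
    · rintro ⟨⟨⟨k, hk⟩, ⟨m, hm⟩⟩, ⟨l, hl⟩⟩
      exact ⟨k, m, l, by ext <;> simp only [hk, hm, hl]⟩
  have hc := Int.isClosedEmbedding_coe_real.isClosed_range
  rw [h]
  exact ((hc.preimage continuous_a).inter (hc.preimage continuous_c)).inter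
    (hc.preimage continuous_b)

/-- The gauge distance from the orbit `Γ g` of the lattice to `w`. -/
noncomputable def orbitDist (w g : Heis) : ℝ := ⨅ γ : lattice, gauge ((γ * g)⁻¹ * w)

theorem orbitDist_le (w g : Heis) (γ : lattice) : orbitDist w g ≤ gauge ((γ * g)⁻¹ * w) :=
  ciInf_le ⟨0, by rintro _ ⟨γ, rfl⟩; exact gauge_nonneg _⟩ γ

theorem orbitDist_self (w : Heis) : orbitDist w w = 0 :=
  le_antisymm ((orbitDist_le w w 1).trans_eq (by simp)) (le_ciInf fun _ => gauge_nonneg _)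

theorem orbitDist_lattice_mul (w g : Heis) (γ : lattice) :
    orbitDist w (γ * g) = orbitDist w g :=
  (Equiv.mulRight γ).iInf_congr fun δ => by simp [mul_assoc]

theorem orbitDist_mul_le (w g h : Heis) : orbitDist w (g * h) ≤ gauge h⁻¹ + orbitDist w g := by
  rw [← sub_le_iff_le_add']
  refine le_ciInf fun γ => sub_le_iff_le_add'.2 ?_
  calc _ ≤ gauge ((γ * (g * h))⁻¹ * w) := orbitDist_le w _ γ
    _ = gauge (h⁻¹ * ((γ * g)⁻¹ * w)) := by simp only [mul_inv_rev, mul_assoc]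
    _ ≤ _ := gauge_mul_le _ _

theorem abs_orbitDist_mul_sub_le (w g h : Heis) :
    |orbitDist w (g * h) - orbitDist w g| ≤ 2 * gauge h := by
  have hle := orbitDist_mul_le w g h
  have hge := orbitDist_mul_le w (g * h) h⁻¹
  rw [mul_inv_cancel_right, inv_inv] at hge
  rw [abs_le]
  constructor <;> linarith [gauge_inv_le h, gauge_nonneg h]

theorem continuous_orbitDist (w : Heis) : Continuous (orbitDist w) := by
  refine continuous_iff_continuousAt.2 fun g => ?_
  have hg : Tendsto (fun g' => 2 * gauge (g⁻¹ * g')) (𝓝 g) (𝓝 0) := by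
    simpa using ((continuous_gauge.comp (continuous_const_mul g⁻¹)).const_mul 2).tendsto g
  rw [ContinuousAt, tendsto_iff_norm_sub_tendsto_zero]
  refine squeeze_zero (fun _ => norm_nonneg _) (fun g' => ?_) hg
  simpa using abs_orbitDist_mul_sub_le w g (g⁻¹ * g')

theorem mul_inv_mem_lattice_of_orbitDist_eq_zero {w g : Heis} (h : orbitDist w g = 0) :
    g * w⁻¹ ∈ lattice := by
  have hex : ∀ n : ℕ, ∃ γ : lattice, gauge ((γ * g)⁻¹ * w) < 1 / ((n : ℝ) + 1) := fun n =>
    exists_lt_of_ciInf_lt (by rw [← orbitDist, h]; positivity)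
  choose γ hγ using hex
  have hgauge : Tendsto (fun n => gauge ((γ n * g)⁻¹ * w)) atTop (𝓝 0) :=
    squeeze_zero (fun _ => gauge_nonneg _) (fun n => (hγ n).le)
      tendsto_one_div_add_atTop_nhds_zero_nat
  have hlim : Tendsto (fun n => (((γ n)⁻¹ : lattice) : Heis)) atTop (𝓝 (g * w⁻¹)) := by
    have := ((tendsto_one_of_tendsto_gauge hgauge).const_mul g).mul_const w⁻¹
    simpa [mul_assoc] using this
  exact isClosed_lattice.mem_of_tendsto hlim (Eventually.of_forall fun n => SetLike.coe_mem _)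

end Heis

namespace HeisNil

theorem mk_eq_mk_iff {g h : Heis} : mk g = mk h ↔ h * g⁻¹ ∈ Heis.lattice := by
  rw [mk, mk, ← QuotientGroup.rightRel_apply]
  exact Quotient.eq

/-- The gauge distance to the point `Γ w`, as a function on the nilmanifold. -/
noncomputable def gaugeDist (w : Heis) : HeisNil → ℝ :=
  Quotient.lift (Heis.orbitDist w) fun g h hgh => by
    have hmem : h * g⁻¹ ∈ Heis.lattice := mk_eq_mk_iff.1 (Quotient.sound hgh)
    simpa using (Heis.orbitDist_lattice_mul w g ⟨h * g⁻¹, hmem⟩).symm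

theorem gaugeDist_mk_self (w : Heis) : gaugeDist w (mk w) = 0 := Heis.orbitDist_self w

theorem continuous_gaugeDist (w : Heis) : Continuous (gaugeDist w) :=
  (Heis.continuous_orbitDist w).quotient_lift _

theorem abs_gaugeDist_rmul_sub_le (w : Heis) (y : HeisNil) (h : Heis) :
    |gaugeDist w (rmul y h) - gaugeDist w y| ≤ 2 * h.gauge := by
  obtain ⟨g, rfl⟩ := isOpenQuotientMap_mk.surjective y
  exact Heis.abs_orbitDist_mul_sub_le w g h

theorem eq_mk_of_gaugeDist_eq_zero {w : Heis} {y : HeisNil} (h : gaugeDist w y = 0) :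
    y = mk w := by
  obtain ⟨g, rfl⟩ := isOpenQuotientMap_mk.surjective y
  exact (mk_eq_mk_iff.2 (Heis.mul_inv_mem_lattice_of_orbitDist_eq_zero h)).symm

end HeisNil

/-- `f` is Lipschitz with constant `C` along the translations `(t, y) ↦ (t + s, y h)` of the phase
space, the size of such a translation being `‖s‖ + h.gauge`. -/
def IsTranslationLipschitz (C : ℝ) (f : CircleHeis → ℂ) : Prop :=
  ∀ (t s : UnitAddCircle) (y : HeisNil) (h : Heis),
    ‖f (t + s, HeisNil.rmul y h) - f (t, y)‖ ≤ C * (‖s‖ + h.gauge)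

theorem norm_mul_sub_mul_le {R : Type*} [NonUnitalSeminormedRing R] (a b a' b' : R) :
    ‖a * b - a' * b'‖ ≤ ‖a‖ * ‖b - b'‖ + ‖a - a'‖ * ‖b'‖ :=
  calc ‖a * b - a' * b'‖ = ‖a * (b - b') + (a - a') * b'‖ := by
        rw [mul_sub, sub_mul, sub_add_sub_cancel]
    _ ≤ _ := norm_add_le_of_le (norm_mul_le _ _) (norm_mul_le _ _)

namespace IsTranslationLipschitz

variable {C D : ℝ} {f g : C(CircleHeis, ℂ)}

theorem add (hf : IsTranslationLipschitz C f) (hg : IsTranslationLipschitz D g) :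
    IsTranslationLipschitz (C + D) ⇑(f + g) := fun t s y h => by
  rw [ContinuousMap.add_apply, ContinuousMap.add_apply, add_sub_add_comm, add_mul]
  exact norm_add_le_of_le (hf t s y h) (hg t s y h)

theorem mul (hf : IsTranslationLipschitz C f) (hg : IsTranslationLipschitz D g) :
    IsTranslationLipschitz (‖f‖ * D + C * ‖g‖) ⇑(f * g) := fun t s y h =>
  calc _ ≤ _ := norm_mul_sub_mul_le _ _ _ _
    _ ≤ ‖f‖ * (D * (‖s‖ + h.gauge)) + C * (‖s‖ + h.gauge) * ‖g‖ := by
        have hfs := hf t s y h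
        gcongr
        · exact f.norm_coe_le_norm _
        · exact hg t s y h
        · exact (norm_nonneg _).trans hfs
        · exact g.norm_coe_le_norm _
    _ = _ := by ring

theorem star (hf : IsTranslationLipschitz C f) : IsTranslationLipschitz C ⇑(star f) :=
  fun t s y h => by
    rw [ContinuousMap.star_apply, ContinuousMap.star_apply, ← star_sub, norm_star]
    exact hf t s y h

end IsTranslationLipschitz

/-- The star algebra of continuous functions on the phase space that are Lipschitz along
translations. -/
def lipschitzAlgebra : StarSubalgebra ℂ C(CircleHeis, ℂ) where
  carrier := {f | ∃ C : ℝ, IsTranslationLipschitz C f}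
  mul_mem' := fun ⟨_, hf⟩ ⟨_, hg⟩ => ⟨_, hf.mul hg⟩
  add_mem' := fun ⟨_, hf⟩ ⟨_, hg⟩ => ⟨_, hf.add hg⟩
  algebraMap_mem' _ := ⟨0, fun t s y h => by simp⟩
  star_mem' := fun ⟨_, hf⟩ => ⟨_, hf.star⟩

/-- The distance to `t₀` in the circle coordinate. -/
noncomputable def circleDist (t₀ : UnitAddCircle) : C(CircleHeis, ℂ) :=
  ⟨fun p => (‖p.1 - t₀‖ : ℝ), by fun_prop⟩

/-- The gauge distance to `Γ w` in the nilmanifold coordinate. -/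
noncomputable def fibreDist (w : Heis) : C(CircleHeis, ℂ) :=
  ⟨fun p => (HeisNil.gaugeDist w p.2 : ℝ),
    Complex.continuous_ofReal.comp ((HeisNil.continuous_gaugeDist w).comp continuous_snd)⟩

theorem circleDist_mem_lipschitzAlgebra (t₀ : UnitAddCircle) :
    circleDist t₀ ∈ lipschitzAlgebra := by
  refine ⟨1, fun t s y h => ?_⟩
  change ‖((‖t + s - t₀‖ : ℝ) : ℂ) - (‖t - t₀‖ : ℝ)‖ ≤ _
  rw [← Complex.ofReal_sub, Complex.norm_real, one_mul]
  calc |‖t + s - t₀‖ - ‖t - t₀‖| ≤ ‖t + s - t₀ - (t - t₀)‖ := abs_norm_sub_norm_le _ _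
    _ = ‖s‖ := by abel_nf
    _ ≤ _ := le_add_of_nonneg_right h.gauge_nonneg

theorem fibreDist_mem_lipschitzAlgebra (w : Heis) : fibreDist w ∈ lipschitzAlgebra := by
  refine ⟨2, fun t s y h => ?_⟩
  change ‖(HeisNil.gaugeDist w (HeisNil.rmul y h) : ℂ) - (HeisNil.gaugeDist w y : ℝ)‖ ≤ _
  rw [← Complex.ofReal_sub, Complex.norm_real, mul_add]
  exact (HeisNil.abs_gaugeDist_rmul_sub_le w y h).trans
    (le_add_of_nonneg_left (by positivity))

theorem separatesPoints_lipschitzAlgebra : lipschitzAlgebra.toSubalgebra.SeparatesPoints := by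
  rintro ⟨t₁, y₁⟩ ⟨t₂, y₂⟩ hne
  by_cases ht : t₁ = t₂
  · obtain ⟨w, rfl⟩ := HeisNil.isOpenQuotientMap_mk.surjective y₂
    refine ⟨_, ⟨fibreDist w, fibreDist_mem_lipschitzAlgebra w, rfl⟩, fun heq => hne ?_⟩
    have hdist : HeisNil.gaugeDist w y₁ = HeisNil.gaugeDist w (HeisNil.mk w) :=
      Complex.ofReal_injective heq
    rw [HeisNil.gaugeDist_mk_self] at hdist
    rw [ht, HeisNil.eq_mk_of_gaugeDist_eq_zero hdist]
  · refine ⟨_, ⟨circleDist t₂, circleDist_mem_lipschitzAlgebra t₂, rfl⟩, fun heq => ht ?_⟩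
    have hdist : ‖t₁ - t₂‖ = ‖t₂ - t₂‖ := Complex.ofReal_injective heq
    rwa [sub_self, norm_zero, norm_sub_eq_zero_iff] at hdist

theorem isLinearlyDense_lipschitzAlgebra :
    IsLinearlyDense (lipschitzAlgebra : Set C(CircleHeis, ℂ)) := by
  have hdense : Dense (lipschitzAlgebra : Set C(CircleHeis, ℂ)) := by
    rw [dense_iff_closure_eq, ← StarSubalgebra.topologicalClosure_coe,
      ContinuousMap.starSubalgebra_topologicalClosure_eq_top_of_separatesPoints _
        separatesPoints_lipschitzAlgebra, StarSubalgebra.coe_top]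
  exact hdense.mono Submodule.subset_span

/-! ### Iterates of the skew product -/

namespace Heis

/-- The central element of the Heisenberg group with corner entry `s`. -/
def central (s : ℝ) : Heis := ⟨0, s, 0⟩

@[simp] theorem central_zero : central 0 = 1 := rfl

theorem central_add (s t : ℝ) : central (s + t) = central s * central t := by
  ext <;> simp [central]

theorem commute_central (s : ℝ) (g : Heis) : Commute (central s) g := by
  ext <;> simp [central, add_comm]

theorem gauge_central (s : ℝ) : (central s).gauge = √|s| := by
  simp [gauge, central, Real.sqrt_nonneg]

theorem gauge_mul_central_le {g : Heis} {β K τ : ℝ} (hK : 1 ≤ K) (hτ0 : 0 ≤ τ) (hτ1 : τ ≤ 1)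
    (ha : |g.a| ≤ K * τ) (hb : |g.b| ≤ K * τ) (hc : |g.c - β| ≤ K * τ) :
    (g * central (-β)).gauge ≤ K * √τ := by
  have hτ : τ ≤ √τ := Real.le_sqrt_of_sq_le (by nlinarith)
  have hKτ : K * τ ≤ K * √τ := by gcongr
  refine gauge_le (by positivity) ?_ ?_ ?_ <;>
    simp only [central, mul_a, mul_b, mul_c, add_zero, mul_zero, ← sub_eq_add_neg]
  · exact ha.trans hKτ
  · exact hb.trans hKτ
  · rw [mul_pow, Real.sq_sqrt hτ0]
    exact hc.trans (by gcongr; exact le_self_pow₀ hK two_ne_zero)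

end Heis

theorem HeisNil.rmul_mul_central_intCast (y : HeisNil) (g : Heis) (k : ℤ) :
    rmul y (g * Heis.central k) = rmul y g := by
  obtain ⟨w, rfl⟩ := isOpenQuotientMap_mk.surjective y
  rw [rmul_mk, rmul_mk, ← mul_assoc, ← (Heis.commute_central k (w * g)).eq, eq_comm, mk_eq_mk_iff,
    mul_inv_cancel_right]
  exact ⟨0, k, 0, by simp [Heis.central]⟩

theorem IsTranslationLipschitz.norm_rmul_sub_le {D : ℝ} {f : CircleHeis → ℂ}
    (hf : IsTranslationLipschitz D f) (t s : UnitAddCircle) (y : HeisNil) (g : Heis) (k : ℤ) :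
    ‖f (t + s, HeisNil.rmul y g) - f (t, y)‖ ≤
      D * (‖s‖ + (g * Heis.central (-k)).gauge) := by
  have h := hf t s y (g * Heis.central (-k : ℤ))
  rwa [HeisNil.rmul_mul_central_intCast, Int.cast_neg] at h

/-- The fibre element of the `n`-th iterate of the skew product over `T` with fibre element
`!![1, φ t, ψ t; 0, 1, η t; 0, 0, 1]`. -/
noncomputable def iterCocycle (T : UnitAddCircle → UnitAddCircle) (φ η ψ : C(UnitAddCircle, ℝ))
    (n : ℕ) (t : UnitAddCircle) : Heis :=
  ⟨birkhoffSum T φ n t, birkhoffSum T ψ n t + doubleBirkhoffSum T φ η n t, birkhoffSum T η n t⟩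

section IterCocycle

variable (T : UnitAddCircle → UnitAddCircle) (φ η ψ : C(UnitAddCircle, ℝ))

@[simp] theorem iterCocycle_zero (t : UnitAddCircle) : iterCocycle T φ η ψ 0 t = 1 := by
  ext <;> simp [iterCocycle, doubleBirkhoffSum]

theorem iterCocycle_succ (n : ℕ) (t : UnitAddCircle) :
    iterCocycle T φ η ψ (n + 1) t = iterCocycle T φ η ψ n t * cocycle φ η ψ (T^[n] t) := by
  ext
  · simp [iterCocycle, cocycle, birkhoffSum_succ]
  · simp only [iterCocycle, doubleBirkhoffSum, cocycle, birkhoffSum_succ, Finset.sum_range_succ,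
      Heis.mul_c]
    ring
  · simp [iterCocycle, cocycle, birkhoffSum_succ]

theorem iterCocycle_add (m n : ℕ) (t : UnitAddCircle) :
    iterCocycle T φ η ψ (m + n) t =
      iterCocycle T φ η ψ m t * iterCocycle T φ η ψ n (T^[m] t) := by
  induction n with
  | zero => simp
  | succ n ih =>
    rw [← add_assoc, iterCocycle_succ, ih, iterCocycle_succ, mul_assoc,
      ← Function.iterate_add_apply, add_comm n m]

theorem skewProduct_pow_apply (α : ℝ) (n : ℕ) (t : UnitAddCircle) (y : HeisNil) :
    (skewProduct α φ η ψ ^ n) (t, y) =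
      (t + n • (α : UnitAddCircle),
        HeisNil.rmul y (iterCocycle (· + (α : UnitAddCircle)) φ η ψ n t)) := by
  induction n with
  | zero => simp [HeisNil.rmul_one]
  | succ n ih =>
    rw [pow_succ', Homeomorph.mul_apply, ih, iterCocycle_succ, ← HeisNil.rmul_rmul, succ_nsmul,
      ← add_assoc, add_right_iterate]
    rfl

variable {T φ η ψ}

theorem gauge_iterCocycle_mul_le {q : ℕ} {β τ : ℝ}
    (h : ∀ t, (iterCocycle T φ η ψ q t * Heis.central (-β)).gauge ≤ τ) (J : ℕ)
    (t : UnitAddCircle) :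
    (iterCocycle T φ η ψ (J * q) t * Heis.central (-(J * β))).gauge ≤ J * τ := by
  induction J with
  | zero => simp
  | succ J ih =>
    set g := iterCocycle T φ η ψ (J * q) t
    set g' := iterCocycle T φ η ψ q (T^[J * q] t)
    have hsplit : iterCocycle T φ η ψ ((J + 1) * q) t * Heis.central (-((J + 1 : ℕ) * β)) =
        g * Heis.central (-(J * β)) * (g' * Heis.central (-β)) := by
      rw [add_one_mul, iterCocycle_add, Nat.cast_succ, add_one_mul, neg_add, Heis.central_add,
        (Heis.commute_central _ g').mul_mul_mul_comm]
    rw [hsplit, Nat.cast_succ, add_one_mul]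
    exact (Heis.gauge_mul_le _ _).trans (add_le_add ih (h _))

end IterCocycle

theorem exists_gauge_iterCocycle_le {φ η ψ : C(UnitAddCircle, ℝ)} {Cφ Cη Cψ ε : ℝ} (hε : 0 < ε)
    (hφ : HasFourierDecay φ Cφ (2 + 2 * ε)) (hη : HasFourierDecay η Cη (2 + 2 * ε))
    (hψ : HasFourierDecay ψ Cψ (1 + ε)) (hφ0 : circleCoeff φ 0 = 0) (hη0 : circleCoeff η 0 = 0)
    (C₀ : ℝ) :
    ∃ C : ℝ, 0 ≤ C ∧ ∀ (x : UnitAddCircle) (q : ℕ) (Q : ℝ), IsGoodDenominator x ε C₀ q Q →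
      ∃ β : ℝ, ∀ t, (iterCocycle (· + x) φ η ψ q t * Heis.central (-β)).gauge ≤
        C * (q : ℝ) ^ (-(ε / 10)) := by
  obtain ⟨C, hC⟩ := exists_birkhoffSum_bounds hε hφ hη hψ hφ0 hη0 C₀
  refine ⟨max 1 C, by positivity, fun x q Q h => ?_⟩
  obtain ⟨β, hβ⟩ := hC x q Q h
  refine ⟨β, fun t => ?_⟩
  set τ : ℝ := (q : ℝ) ^ (-(ε / 5))
  have hτ : √τ = (q : ℝ) ^ (-(ε / 10)) := by
    rw [Real.sqrt_eq_rpow, ← Real.rpow_mul (by positivity)]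
    ring_nf
  have hle : C * τ ≤ max 1 C * τ := by
    gcongr
    exact le_max_right _ _
  rw [← hτ]
  exact Heis.gauge_mul_central_le (le_max_left _ _) (by positivity)
    (Real.rpow_le_one_of_one_le_of_nonpos h.one_le_cast (by linarith))
    ((hβ t).1.trans hle) ((hβ t).2.1.trans hle) ((hβ t).2.2.trans hle)

/-! ### Rigidity times -/

theorem IsTranslationLipschitz.nonneg {D : ℝ} {f : CircleHeis → ℂ}
    (hf : IsTranslationLipschitz D f) : 0 ≤ D := by
  have h := (norm_nonneg _).trans (hf 0 0 (HeisNil.mk 1) (Heis.central 1))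
  simpa [Heis.gauge_central] using h

theorem exists_nat_mul_near_int (β : ℝ) {N : ℝ} (hN : 1 ≤ N) :
    ∃ (v : ℕ) (k : ℤ), 1 ≤ v ∧ (v : ℝ) ≤ N ∧ |v * β - k| ≤ N⁻¹ := by
  obtain ⟨k, j, hj0, hjN, h⟩ := Real.exists_int_int_abs_mul_sub_le β (Nat.floor_pos.2 hN)
  lift j to ℕ using hj0.le
  refine ⟨j, k, by exact_mod_cast hj0, ?_, ?_⟩
  · exact (Nat.cast_le.2 (by exact_mod_cast hjN)).trans (Nat.floor_le (by positivity))
  · refine h.trans ?_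
    rw [one_div]
    exact inv_anti₀ (by positivity) (Nat.lt_floor_add_one N).le

/-- `r` is a polynomial rigidity time of `S`, at scale `ε` and with constant `C`: the iterates
`S ^ (j r)`, `j ≤ r ^ (ε / 128)`, displace every translation-Lipschitz function by at most a
constant times `r ^ (-(ε / 100))`. -/
def IsRigidityTime (S : CircleHeis ≃ₜ CircleHeis) (C ε : ℝ) (r : ℕ) : Prop :=
  ∀ (f : C(CircleHeis, ℂ)) (D : ℝ), IsTranslationLipschitz D f →
    ∀ j : ℕ, (j : ℝ) ≤ (r : ℝ) ^ (ε / 128) → ∀ z,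
      ‖f ((S ^ (j * r)) z) - f z‖ ≤ D * (C * (r : ℝ) ^ (-(ε / 100)))

section SkewProduct

variable {α ε C β : ℝ} {φ η ψ : C(UnitAddCircle, ℝ)} {q : ℕ}

theorem norm_skewProduct_pow_sub_le (hε : 0 < ε) (hε1 : ε ≤ 1) (hq : 1 ≤ q) (hC : 0 ≤ C)
    (hqα : ‖q • (α : UnitAddCircle)‖ ≤ 1 / q)
    (h : ∀ t, (iterCocycle (· + (α : UnitAddCircle)) φ η ψ q t * Heis.central (-β)).gauge ≤
      C * (q : ℝ) ^ (-(ε / 10)))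
    {f : C(CircleHeis, ℂ)} {D : ℝ} (hf : IsTranslationLipschitz D f) {J : ℕ} {k : ℤ}
    (hJ : (J : ℝ) ≤ (q : ℝ) ^ (5 * ε / 64)) (hk : |J * β - k| ≤ (q : ℝ) ^ (-(3 * ε / 64)))
    (z : CircleHeis) :
    ‖f ((skewProduct α φ η ψ ^ (J * q)) z) - f z‖ ≤ D * ((C + 2) * (q : ℝ) ^ (-(ε / 50))) := by
  obtain ⟨t, y⟩ := z
  have hq1 : (1 : ℝ) ≤ q := by exact_mod_cast hq
  have hle : ∀ {a b : ℝ}, a ≤ b → (q : ℝ) ^ a ≤ (q : ℝ) ^ b := fun hab =>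
    Real.rpow_le_rpow_of_exponent_le hq1 hab
  have hJmul : ∀ a : ℝ, 5 * ε / 64 + a ≤ -(ε / 50) →
      J * (q : ℝ) ^ a ≤ (q : ℝ) ^ (-(ε / 50)) := fun a ha =>
    calc J * (q : ℝ) ^ a ≤ (q : ℝ) ^ (5 * ε / 64) * (q : ℝ) ^ a := by gcongr
      _ = (q : ℝ) ^ (5 * ε / 64 + a) := (Real.rpow_add (by positivity) _ _).symm
      _ ≤ _ := hle ha
  have hcircle : ‖(J * q) • (α : UnitAddCircle)‖ ≤ (q : ℝ) ^ (-(ε / 50)) :=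
    calc ‖(J * q) • (α : UnitAddCircle)‖ ≤ J * ‖q • (α : UnitAddCircle)‖ := by
          rw [mul_smul]
          exact norm_nsmul_le
      _ ≤ J * (q : ℝ) ^ (-1 : ℝ) := by
          rw [Real.rpow_neg_one, ← one_div]
          gcongr
      _ ≤ _ := hJmul _ (by linarith)
  have hcentral : (Heis.central (J * β - k)).gauge ≤ (q : ℝ) ^ (-(ε / 50)) := by
    rw [Heis.gauge_central, Real.sqrt_le_left (by positivity),
      ← Real.rpow_mul_natCast (by positivity)]
    exact hk.trans (hle (by push_cast; linarith))
  set g := iterCocycle (· + (α : UnitAddCircle)) φ η ψ (J * q) t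
  have hfibre : (g * Heis.central (-k)).gauge ≤ (C + 1) * (q : ℝ) ^ (-(ε / 50)) :=
    calc (g * Heis.central (-k)).gauge
        = (g * Heis.central (-(J * β)) * Heis.central (J * β - k)).gauge := by
          rw [mul_assoc, ← Heis.central_add, neg_add_eq_sub, sub_sub_cancel_left]
      _ ≤ J * (C * (q : ℝ) ^ (-(ε / 10))) + (q : ℝ) ^ (-(ε / 50)) :=
          (Heis.gauge_mul_le _ _).trans (add_le_add (gauge_iterCocycle_mul_le h J t) hcentral)
      _ ≤ C * (q : ℝ) ^ (-(ε / 50)) + (q : ℝ) ^ (-(ε / 50)) := by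
          rw [mul_left_comm]
          gcongr
          exact hJmul _ (by linarith)
      _ = _ := by ring
  rw [skewProduct_pow_apply]
  refine (hf.norm_rmul_sub_le t _ y g k).trans (mul_le_mul_of_nonneg_left ?_ hf.nonneg)
  linarith

theorem exists_isRigidityTime_mul (hε : 0 < ε) (hε1 : ε ≤ 1) (hq : 1 ≤ q) (hC : 0 ≤ C)
    (hqα : ‖q • (α : UnitAddCircle)‖ ≤ 1 / q)
    (h : ∀ t, (iterCocycle (· + (α : UnitAddCircle)) φ η ψ q t * Heis.central (-β)).gauge ≤
      C * (q : ℝ) ^ (-(ε / 10))) :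
    ∃ v : ℕ, 1 ≤ v ∧ (v : ℝ) ≤ (q : ℝ) ^ (ε / 16) ∧
      IsRigidityTime (skewProduct α φ η ψ) (C + 2) ε (v * q) := by
  have hq1 : (1 : ℝ) ≤ q := by exact_mod_cast hq
  obtain ⟨v, k, hv1, hvq, hk⟩ :=
    exists_nat_mul_near_int β (Real.one_le_rpow hq1 (by positivity : 0 ≤ ε / 16))
  refine ⟨v, hv1, hvq, fun f D hf j hj z => ?_⟩
  have hr0 : (0 : ℝ) < (v * q : ℕ) := by exact_mod_cast Nat.mul_pos hv1 hq
  have hr : ((v * q : ℕ) : ℝ) ≤ (q : ℝ) ^ (2 : ℝ) := by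
    have hvq1 : (v : ℝ) ≤ q :=
      hvq.trans ((Real.rpow_le_rpow_of_exponent_le hq1 (by linarith)).trans_eq (Real.rpow_one _))
    rw [Nat.cast_mul, Real.rpow_two, sq]
    gcongr
  have hjq : (j : ℝ) ≤ (q : ℝ) ^ (ε / 64) :=
    calc (j : ℝ) ≤ ((q : ℝ) ^ (2 : ℝ)) ^ (ε / 128) := hj.trans (by gcongr)
      _ = (q : ℝ) ^ (ε / 64) := by rw [← Real.rpow_mul (by positivity)]; ring_nf
  have hJ : ((j * v : ℕ) : ℝ) ≤ (q : ℝ) ^ (5 * ε / 64) :=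
    calc ((j * v : ℕ) : ℝ) ≤ (q : ℝ) ^ (ε / 64) * (q : ℝ) ^ (ε / 16) := by
          rw [Nat.cast_mul]
          gcongr
      _ = _ := by rw [← Real.rpow_add (by positivity)]; ring_nf
  have hJβ : |(j * v : ℕ) * β - (j * k : ℤ)| ≤ (q : ℝ) ^ (-(3 * ε / 64)) :=
    calc |(j * v : ℕ) * β - (j * k : ℤ)| = j * |v * β - k| := by
          push_cast
          rw [mul_assoc, ← mul_sub, abs_mul, Nat.abs_cast]
      _ ≤ (q : ℝ) ^ (ε / 64) * (q : ℝ) ^ (-(ε / 16)) := by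
          rw [Real.rpow_neg (by positivity)]
          gcongr
      _ = _ := by rw [← Real.rpow_add (by positivity)]; ring_nf
  rw [← mul_assoc]
  refine (norm_skewProduct_pow_sub_le hε hε1 hq hC hqα h hf hJ hJβ z).trans ?_
  have := hf.nonneg
  gcongr D * ((C + 2) * ?_)
  calc (q : ℝ) ^ (-(ε / 50)) = ((q : ℝ) ^ (2 : ℝ)) ^ (-(ε / 100)) := by
        rw [← Real.rpow_mul (by positivity)]; ring_nf
    _ ≤ _ := Real.rpow_le_rpow_of_nonpos hr0 hr (by linarith)

end SkewProduct

theorem natAbs_le_of_mem_Icc_floor {M : ℝ} {j : ℤ} (hj : j ∈ Finset.Icc (-⌊M⌋) ⌊M⌋) :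
    (j.natAbs : ℝ) ≤ M := by
  rw [Nat.cast_natAbs, Int.cast_abs]
  exact_mod_cast (Int.cast_le.2 (abs_le.2 (Finset.mem_Icc.1 hj))).trans (Int.floor_le M)

section Rigidity

variable {X : Type*} [TopologicalSpace X]

theorem norm_zpow_sub_le_of_norm_pow_sub_le {T : X ≃ₜ X} {f : X → ℂ} {b : ℝ} {r : ℕ} {j : ℤ}
    (h : ∀ x, ‖f ((T ^ (j.natAbs * r)) x) - f x‖ ≤ b) (x : X) :
    ‖f ((T ^ (j * r)) x) - f x‖ ≤ b := by
  rcases Int.natAbs_eq j with hj | hj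
  · rw [hj]
    exact_mod_cast h x
  · have hcancel : T ^ (j.natAbs * r) * T ^ (j * r) = 1 := by
      rw [← zpow_natCast, ← zpow_add, Nat.cast_mul, ← add_mul, neg_eq_iff_add_eq_zero.1 hj.symm,
        zero_mul, zpow_zero]
    have hx := h ((T ^ (j * r)) x)
    rwa [← Homeomorph.mul_apply, hcancel, Homeomorph.one_apply, norm_sub_rev] at hx

variable [MeasurableSpace X]

theorem rigidityRate_of_norm_pow_sub_le {T : X ≃ₜ X} {ν : Measure X} [IsFiniteMeasure ν]
    {f : C(X, ℂ)} {δ : ℝ} {r : ℕ → ℕ} {B : ℕ → ℝ} (hδ : 0 ≤ δ) (hr : ∀ n, 1 ≤ r n)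
    (hB : ∀ n (j : ℕ), (j : ℝ) ≤ (r n : ℝ) ^ δ → ∀ x, ‖f ((T ^ (j * r n)) x) - f x‖ ≤ B n)
    (hlim : Tendsto (fun n => (r n : ℝ) ^ δ * B n ^ 2) atTop (𝓝 0)) :
    RigidityRate T ν f δ r := by
  have hlim' := hlim.const_mul (3 * ν.real Set.univ)
  rw [mul_zero] at hlim'
  refine squeeze_zero (fun n => Finset.sum_nonneg fun j _ => integral_nonneg fun x => by positivity)
    (fun n => ?_) hlim'
  set M : ℝ := (r n : ℝ) ^ δ
  have hM : 1 ≤ M := Real.one_le_rpow (by exact_mod_cast hr n) hδ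
  have hfloor : 0 ≤ ⌊M⌋ := Int.floor_nonneg.2 (by positivity)
  have hterm : ∀ j ∈ Finset.Icc (-⌊M⌋) ⌊M⌋,
      ∫ x, ‖f ((T ^ (j * (r n : ℤ))) x) - f x‖ ^ 2 ∂ν ≤ B n ^ 2 * ν.real Set.univ := fun j hj => by
    refine (le_abs_self _).trans ?_
    rw [← Real.norm_eq_abs]
    refine norm_integral_le_of_norm_le_const (.of_forall fun x => ?_)
    rw [Real.norm_of_nonneg (by positivity)]
    gcongr
    exact norm_zpow_sub_le_of_norm_pow_sub_le (hB n _ (natAbs_le_of_mem_Icc_floor hj)) x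
  have hcard : ((Finset.Icc (-⌊M⌋) ⌊M⌋).card : ℝ) ≤ 3 * M := by
    have hcast : ((Finset.Icc (-⌊M⌋) ⌊M⌋).card : ℤ) = 2 * ⌊M⌋ + 1 := by
      rw [Int.card_Icc]
      omega
    have : ((Finset.Icc (-⌊M⌋) ⌊M⌋).card : ℝ) = 2 * ⌊M⌋ + 1 := by exact_mod_cast hcast
    linarith [Int.floor_le M]
  calc _ ≤ ((Finset.Icc (-⌊M⌋) ⌊M⌋).card : ℝ) * (B n ^ 2 * ν.real Set.univ) := by
        rw [← nsmul_eq_mul]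
        exact Finset.sum_le_card_nsmul _ _ _ hterm
    _ ≤ 3 * M * (B n ^ 2 * ν.real Set.univ) := by gcongr
    _ = _ := by ring

theorem HasPRRigidityAlong.hasPRRigidity {T : X ≃ₜ X} {ν : Measure X} {r : ℕ → ℕ}
    (h : HasPRRigidityAlong T ν r) (hr : StrictMono r) (hpos : ∀ n, 0 < r n) :
    HasPRRigidity T ν := by
  obtain ⟨F, hF, hrate⟩ := h
  refine ⟨F, hF, fun f hf => ?_⟩
  obtain ⟨δ, hδ, hrate⟩ := hrate f hf
  exact ⟨δ, hδ, r, hr, hpos, hrate⟩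

end Rigidity

theorem hasPRRigidityAlong_of_isRigidityTime {S : CircleHeis ≃ₜ CircleHeis}
    {ν : Measure CircleHeis} [IsFiniteMeasure ν] {C ε : ℝ} (hε : 0 < ε) {r : ℕ → ℕ}
    (hr : StrictMono r) (hpos : ∀ n, 0 < r n) (h : ∀ n, IsRigidityTime S C ε (r n)) :
    HasPRRigidityAlong S ν r := by
  refine ⟨lipschitzAlgebra, isLinearlyDense_lipschitzAlgebra, fun f ⟨D, hf⟩ => ?_⟩
  refine ⟨ε / 128, by positivity, rigidityRate_of_norm_pow_sub_le (by positivity) hpos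
    (fun n => h n f D hf) ?_⟩
  have hdecay : Tendsto (fun n => (D * C) ^ 2 * (r n : ℝ) ^ (-(ε / 50 - ε / 128))) atTop (𝓝 0) := by
    have := ((tendsto_rpow_neg_atTop (by linarith : 0 < ε / 50 - ε / 128)).comp
      (tendsto_natCast_atTop_atTop.comp hr.tendsto_atTop)).const_mul ((D * C) ^ 2)
    rwa [mul_zero] at this
  refine hdecay.congr fun n => ?_
  have hr0 : (0 : ℝ) < r n := by exact_mod_cast hpos n
  have hexp : (r n : ℝ) ^ (-(ε / 50 - ε / 128)) =
      (r n : ℝ) ^ (ε / 128) * ((r n : ℝ) ^ (-(ε / 100))) ^ 2 := by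
    rw [← Real.rpow_mul_natCast hr0.le, ← Real.rpow_add hr0]
    push_cast
    ring_nf
  rw [hexp]
  ring

theorem exists_strictMono_mul_of_frequently {q : ℕ → ℕ} (hq : Tendsto q atTop atTop)
    {P : ℕ → ℕ → Prop} (h : ∃ᶠ n in atTop, ∃ v, 1 ≤ v ∧ P n v) :
    ∃ m v : ℕ → ℕ, StrictMono m ∧ StrictMono (fun n => v n * q (m n)) ∧
      ∀ n, 1 ≤ v n ∧ P (m n) (v n) := by
  obtain ⟨m, hm, hex⟩ := extraction_of_frequently_atTop h
  choose v hv using hex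
  have htop : Tendsto (fun n => v n * q (m n)) atTop atTop :=
    tendsto_atTop_mono (fun n => Nat.le_mul_of_pos_left _ (hv n).1) (hq.comp hm.tendsto_atTop)
  obtain ⟨θ, hθ, hmono⟩ := strictMono_subseq_of_tendsto_atTop htop
  exact ⟨m ∘ θ, v ∘ θ, hm.comp hθ, hmono, fun n => hv (θ n)⟩

theorem one_le_convDen {α : ℝ} (hα : Irrational α) (n : ℕ) : 1 ≤ convDen α n :=
  (isApproxDenominator_convDen hα n).one_le

theorem exists_rigidityTimes {α ε : ℝ} (hα : Irrational α) (hε : 0 < ε) (hε1 : ε ≤ 1)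
    {φ η ψ : C(UnitAddCircle, ℝ)} {Cφ Cη Cψ : ℝ}
    (hφ : HasFourierDecay φ Cφ (2 + 2 * ε)) (hη : HasFourierDecay η Cη (2 + 2 * ε))
    (hψ : HasFourierDecay ψ Cψ (1 + ε)) (hφ0 : circleCoeff φ 0 = 0) (hη0 : circleCoeff η 0 = 0) :
    ∃ (C : ℝ) (m v : ℕ → ℕ), StrictMono m ∧ StrictMono (fun n => v n * convDen α (m n)) ∧
      ∀ n, 1 ≤ v n ∧ (v n : ℝ) ≤ (convDen α (m n) : ℝ) ^ (ε / 16) ∧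
        IsRigidityTime (skewProduct α φ η ψ) C ε (v n * convDen α (m n)) := by
  obtain ⟨C₀, -, hgood⟩ := exists_frequently_isGoodDenominator
    (isApproxDenominator_convDen hα) (tendsto_convDen hα) hε hε1
  obtain ⟨C, hC, hgauge⟩ := exists_gauge_iterCocycle_le hε hφ hη hψ hφ0 hη0 C₀
  refine ⟨C + 2, exists_strictMono_mul_of_frequently (tendsto_convDen hα)
    (P := fun n v => (v : ℝ) ≤ (convDen α n : ℝ) ^ (ε / 16) ∧
      IsRigidityTime (skewProduct α φ η ψ) (C + 2) ε (v * convDen α n)) (hgood.mono ?_)⟩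
  intro n hn
  obtain ⟨β, hβ⟩ := hgauge _ _ _ hn
  refine exists_isRigidityTime_mul hε hε1 hn.one_le hC (hn.norm_nsmul_le.trans ?_) hβ
  have := hn.one_le_cast
  gcongr
  exact_mod_cast hn.le

theorem theorem1p1_general {α : ℝ} (hα : Irrational α) {ε : ℝ} (hε : 0 < ε) {φ η ψ : ℝ → ℝ}
    (hφ : IsSmoothPeriodic (2 + 2 * ε) φ) (hη : IsSmoothPeriodic (2 + 2 * ε) η)
    (hψ : IsSmoothPeriodic (1 + ε) ψ)
    (hφ0 : ∫ t in (0 : ℝ)..1, φ t = 0) (hη0 : ∫ t in (0 : ℝ)..1, η t = 0)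
    {S : CircleHeis ≃ₜ CircleHeis}
    (hS : S = skewProduct α (circleFun φ hφ.periodic hφ.continuous)
      (circleFun η hη.periodic hη.continuous) (circleFun ψ hψ.periodic hψ.continuous)) :
    (∀ (ν : Measure CircleHeis) [IsFiniteMeasure ν], HasPRRigidity S ν) ∧
    ∃ (r m v : ℕ → ℕ), StrictMono m ∧ StrictMono r ∧
      (∀ n, 1 ≤ v n ∧ (v n : ℝ) ≤ (GenContFract.of α).dens (m n) ^ (ε / 16) ∧
        (r n : ℝ) = v n * (GenContFract.of α).dens (m n)) ∧
      ∀ (ν : Measure CircleHeis) [IsFiniteMeasure ν], HasPRRigidityAlong S ν r := by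
  set ε' := min ε 1
  have hε' : 0 < ε' := lt_min hε one_pos
  have hle : ε' ≤ ε := min_le_left _ _
  obtain ⟨Cφ, hFφ⟩ := (hφ.mono (by linarith)).exists_hasFourierDecay (by linarith : 1 < 2 + 2 * ε')
  obtain ⟨Cη, hFη⟩ := (hη.mono (by linarith)).exists_hasFourierDecay (by linarith : 1 < 2 + 2 * ε')
  obtain ⟨Cψ, hFψ⟩ := (hψ.mono (by linarith)).exists_hasFourierDecay (by linarith : 1 < 1 + ε')
  obtain ⟨C, m, v, hm, hr, hv⟩ := exists_rigidityTimes hα hε' (min_le_right _ _) hFφ hFη hFψ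
    (by rw [circleCoeff_circleFun_zero, hφ0, Complex.ofReal_zero])
    (by rw [circleCoeff_circleFun_zero, hη0, Complex.ofReal_zero])
  have hpos : ∀ n, 0 < v n * convDen α (m n) := fun n =>
    Nat.mul_pos (hv n).1 (one_le_convDen hα _)
  have halong : ∀ (ν : Measure CircleHeis) [IsFiniteMeasure ν],
      HasPRRigidityAlong S ν fun n => v n * convDen α (m n) := fun ν _ =>
    hS ▸ hasPRRigidityAlong_of_isRigidityTime hε' hr hpos fun n => (hv n).2.2
  refine ⟨fun ν _ => (halong ν).hasPRRigidity hr hpos, _, m, v, hm, hr,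
    fun n => ⟨(hv n).1, ?_, by rw [← cast_convDen, Nat.cast_mul]⟩, halong⟩
  rw [← cast_convDen]
  exact (hv n).2.1.trans
    (Real.rpow_le_rpow_of_exponent_le (by exact_mod_cast one_le_convDen hα _) (by linarith))

theorem theorem1p1 (α : ℝ) (hα : α ∈ Set.Ico (0 : ℝ) 1) (hirr : Irrational α)
    (ε : ℝ) (hε0 : 0 < ε) (hε1 : ε < 1 / 100) (φ η ψ : ℝ → ℝ)
    (hφ : IsSmoothPeriodic (2 + 2 * ε) φ) (hη : IsSmoothPeriodic (2 + 2 * ε) η)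
    (hψ : IsSmoothPeriodic (1 + ε) ψ)
    (hφ0 : ∫ t in (0 : ℝ)..1, φ t = 0) (hη0 : ∫ t in (0 : ℝ)..1, η t = 0)
    (S : CircleHeis ≃ₜ CircleHeis)
    (hS : S = skewProduct α (circleFun φ hφ.periodic hφ.continuous)
      (circleFun η hη.periodic hη.continuous) (circleFun ψ hψ.periodic hψ.continuous)) :
    (∀ ν : Measure CircleHeis, IsInvariantProb S ν → HasPRRigidity S ν) ∧
    ∃ (r m v : ℕ → ℕ), StrictMono m ∧ StrictMono r ∧
      (∀ n, 1 ≤ v n ∧ (v n : ℝ) ≤ (GenContFract.of α).dens (m n) ^ (ε / 16) ∧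
        (r n : ℝ) = v n * (GenContFract.of α).dens (m n)) ∧
      ∀ ν : Measure CircleHeis, IsInvariantProb S ν → HasPRRigidityAlong S ν r := by
  obtain ⟨hrig, r, m, v, hm, hr, hv, halong⟩ := theorem1p1_general hirr hε0 hφ hη hψ hφ0 hη0 hS
  exact ⟨fun ν h => have := h.1; hrig ν, r, m, v, hm, hr, hv, fun ν h => have := h.1; halong ν⟩
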